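/- Let $\Bbbk$ be an algebraically closed field of characteristic $0$. For an augmented $\Bbbk$-algebra $A$ and an $A$-module $M$ put $\operatorname{H}(A,M)=\bigoplus_{n\ge 0}\operatorname{Ext}^n_A(\Bbbk,M)$, where $\Bbbk$ is the trivial $A$-module given by the augmentation; $\operatorname{H}(A,\Bbbk)$ is a $\Bbbk$-algebra and $\operatorname{H}(A,M)$ an $\operatorname{H}(A,\Bbbk)$-module by means of the Yoneda product. One says that $A$ has finitely generated cohomology if (a) $\operatorname{H}(A,\Bbbk)$ is a finitely generated $\Bbbk$-algebra, and (b) for every finitely generated $A$-module $M$, $\operatorname{H}(A,M)$ is a finitely generated $\operatorname{H}(A,\Bbbk)$-module. Theorem. Let $\Gamma$ be a finite group and let $R$ be a finite-dimensional Hopf algebra in the braided category ${}^{\Bbbk\Gamma}_{\Bbbk\Gamma}\mathcal{YD}$ of Yetter–Drinfeld modules over the group algebra $\Bbbk\Gamma$. If $R$ (augmented by its counit) has finitely generated cohomology, then so does the bosonization $R\#\Bbbk\Gamma$ (with product $(r\# g)(s\# h)=r(g\cdot s)\# gh$, augmented by its counit $\varepsilon(r\# g)=\varepsilon_R(r)$).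 -/

import Mathlib

open CategoryTheory CategoryTheory.Abelian
open scoped DirectSum TensorProduct

universe w v u

noncomputable section

/-! ### The Yoneda algebra `⨁ n, Extⁿ(X, X)` and its modules `⨁ n, Extⁿ(X, Y)`

The product is the Yoneda product, written in diagrammatic order (`α * β` is "first `α`, then `β`"),
so that `⨁ n, Extⁿ(X, Y)` is a left module over `⨁ n, Extⁿ(X, X)`. -/

namespace YonedaExt

variable {C : Type u} [Category.{v} C] [Abelian C] [HasExt.{w} C]

theorem mk_comp_congr {X Y Z : C} {a b c c' : ℕ} (α : Ext X Y a) (β : Ext Y Z b)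
    (h : a + b = c) (h' : a + b = c') :
    GradedMonoid.mk (A := fun n => Ext X Z n) c (α.comp β h) =
      GradedMonoid.mk c' (α.comp β h') := by
  subst h; subst h'; rfl

instance gMul (X : C) : GradedMonoid.GMul (fun n : ℕ => Ext X X n) where
  mul α β := α.comp β rfl

instance gOne (X : C) : GradedMonoid.GOne (fun n : ℕ => Ext X X n) where
  one := Ext.mk₀ (𝟙 X)

instance gMonoid (X : C) : GradedMonoid.GMonoid (fun n : ℕ => Ext X X n) where
  one_mul := by
    rintro ⟨n, α⟩
    change GradedMonoid.mk (A := fun n => Ext X X n) (0 + n)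
      ((Ext.mk₀ (𝟙 X)).comp α rfl) = GradedMonoid.mk n α
    rw [mk_comp_congr _ _ rfl (zero_add n), Ext.mk₀_id_comp]
  mul_one := by
    rintro ⟨n, α⟩
    change GradedMonoid.mk (A := fun n => Ext X X n) (n + 0)
      (α.comp (Ext.mk₀ (𝟙 X)) rfl) = GradedMonoid.mk n α
    rw [mk_comp_congr _ _ rfl (add_zero n), Ext.comp_mk₀_id]
  mul_assoc := by
    rintro ⟨a, α⟩ ⟨b, β⟩ ⟨c, γ⟩
    change GradedMonoid.mk (A := fun n => Ext X X n) (a + b + c)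
      ((α.comp β rfl).comp γ rfl) = GradedMonoid.mk (a + (b + c)) (α.comp (β.comp γ rfl) rfl)
    rw [Ext.comp_assoc α β γ rfl rfl rfl]
    exact mk_comp_congr _ _ _ _

instance gSemiring (X : C) : DirectSum.GSemiring (fun n : ℕ => Ext X X n) where
  mul_zero α := Ext.comp_zero α _ _ _ _
  zero_mul β := Ext.zero_comp _ _ β _ _
  mul_add α β γ := Ext.comp_add α β γ _
  add_mul α β γ := Ext.add_comp α β γ _
  natCast n := n • Ext.mk₀ (𝟙 X)
  natCast_zero := zero_nsmul _
  natCast_succ n := succ_nsmul _ n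

instance gModule (X Y : C) :
    DirectSum.Gmodule (fun n : ℕ => Ext X X n) (fun n : ℕ => Ext X Y n) where
  smul α β := α.comp β rfl
  one_smul := by
    rintro ⟨n, α⟩
    change GradedMonoid.mk (A := fun n => Ext X Y n) (0 + n)
      ((Ext.mk₀ (𝟙 X)).comp α rfl) = GradedMonoid.mk n α
    rw [mk_comp_congr _ _ rfl (zero_add n), Ext.mk₀_id_comp]
  mul_smul := by
    rintro ⟨a, α⟩ ⟨b, β⟩ ⟨c, γ⟩
    change GradedMonoid.mk (A := fun n => Ext X Y n) (a + b + c)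
      ((α.comp β rfl).comp γ rfl) = GradedMonoid.mk (a + (b + c)) (α.comp (β.comp γ rfl) rfl)
    rw [Ext.comp_assoc α β γ rfl rfl rfl]
    exact mk_comp_congr _ _ _ _
  smul_add α β γ := Ext.comp_add α β γ _
  smul_zero α := Ext.comp_zero α _ _ _ _
  add_smul α β γ := Ext.add_comp α β γ _
  zero_smul β := Ext.zero_comp _ _ β _ _

instance gAlgebra (k : Type*) [Field k] [Linear k C] (X : C) :
    DirectSum.GAlgebra k (fun n : ℕ => Ext X X n) where
  toFun :=
    { toFun := fun r => r • Ext.mk₀ (𝟙 X)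
      map_zero' := zero_smul _ _
      map_add' := fun r s => add_smul r s _ }
  map_one := one_smul k _
  map_mul r s := by
    change GradedMonoid.mk (A := fun n => Ext X X n) 0 ((r * s) • Ext.mk₀ (𝟙 X)) =
      GradedMonoid.mk (0 + 0) ((r • Ext.mk₀ (𝟙 X)).comp (s • Ext.mk₀ (𝟙 X)) rfl)
    rw [mk_comp_congr _ _ rfl (zero_add 0), Ext.smul_comp, Ext.mk₀_id_comp, mul_smul]
  commutes := by
    rintro r ⟨n, α⟩
    change GradedMonoid.mk (A := fun n => Ext X X n) (0 + n) ((r • Ext.mk₀ (𝟙 X)).comp α rfl) =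
      GradedMonoid.mk (n + 0) (α.comp (r • Ext.mk₀ (𝟙 X)) rfl)
    rw [mk_comp_congr _ _ rfl (zero_add n), mk_comp_congr _ _ rfl (add_zero n), Ext.smul_comp,
      Ext.comp_smul, Ext.mk₀_id_comp, Ext.comp_mk₀_id]
  smul_def := by
    rintro r ⟨n, α⟩
    change GradedMonoid.mk (A := fun n => Ext X X n) n (r • α) =
      GradedMonoid.mk (0 + n) ((r • Ext.mk₀ (𝟙 X)).comp α rfl)
    rw [mk_comp_congr _ _ rfl (zero_add n), Ext.smul_comp, Ext.mk₀_id_comp]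

end YonedaExt

/-! ### Cohomology of augmented algebras -/

section Cohomology

variable {k A : Type u} [Field k] [Ring A] [Algebra k A]

/-- The trivial module `k` of an augmented algebra `(A, ε)`: the field `k` with `a • x = ε(a) x`. -/
abbrev trivialModule (ε : A →ₐ[k] k) : ModuleCat.{u} A :=
  (ModuleCat.restrictScalars (ε : A →+* k)).obj (ModuleCat.of k k)

/-- `H(A, M) = ⨁ₙ Extⁿ_A(k, M)`, for an augmented algebra `(A, ε)` and an `A`-module `M`. -/
abbrev CohomologyModule (ε : A →ₐ[k] k) (M : ModuleCat.{u} A) : Type u :=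
  ⨁ n : ℕ, Ext (trivialModule ε) M n

/-- The cohomology algebra `H(A, k) = ⨁ₙ Extⁿ_A(k, k)` of an augmented algebra `(A, ε)`, with the
Yoneda product. -/
abbrev CohomologyAlgebra (ε : A →ₐ[k] k) : Type u :=
  ⨁ n : ℕ, Ext (trivialModule ε) (trivialModule ε) n

/-- An augmented algebra `(A, ε)` over `k` has finitely generated cohomology if `H(A, k)` is a
finitely generated `k`-algebra and if `H(A, M)` is a finitely generated `H(A, k)`-module for every
finitely generated `A`-module `M`. -/
structure HasFinitelyGeneratedCohomology (ε : A →ₐ[k] k) : Prop where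
  finiteType : Algebra.FiniteType k (CohomologyAlgebra ε)
  finite : ∀ M : ModuleCat.{u} A, Module.Finite A M →
    Module.Finite (CohomologyAlgebra ε) (CohomologyModule ε M)

end Cohomology

/-! ### Hopf algebras in Yetter–Drinfeld modules over a group algebra

A Yetter–Drinfeld module over `k Γ` is a `k`-linear representation `V` of `Γ` with a decomposition
`V = ⨁ g, V_g` (the `k Γ`-coaction being `v ↦ g ⊗ v` for `v ∈ V_g`) such that
`g • V_h ⊆ V_{g h g⁻¹}`. Morphisms are the `Γ`-equivariant degree-preserving linear maps;
tensor products carry the diagonal action and the degree `deg (v ⊗ w) = deg v * deg w`; the unit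
object is `k` with trivial action and in degree `1`. -/

section YetterDrinfeld

variable (k : Type*) {Γ R : Type*} [Field k] [Group Γ] [DecidableEq Γ]

/-- The action of `g` as a `k`-linear map. -/
def groupAct (V : Type*) [AddCommGroup V] [Module k V] [DistribMulAction Γ V]
    [SMulCommClass Γ k V] (g : Γ) : V →ₗ[k] V where
  toFun v := g • v
  map_add' := smul_add g
  map_smul' r v := smul_comm g r v

/-- The braiding `c : V ⊗ W → W ⊗ V`, `c (v ⊗ w) = (g • w) ⊗ v` for `v ∈ V_g`. -/
def ydBraiding {V : Type*} (W : Type*) [AddCommGroup V] [Module k V] [AddCommGroup W] [Module k W]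
    [DistribMulAction Γ W] [SMulCommClass Γ k W]
    (𝒱 : Γ → Submodule k V) [DirectSum.Decomposition 𝒱] : V ⊗[k] W →ₗ[k] W ⊗[k] V :=
  TensorProduct.lift
    (DirectSum.toModule k Γ (W →ₗ[k] W ⊗[k] V)
        (fun g => ((TensorProduct.mk k W V).compl₁₂ (groupAct k W g) (𝒱 g).subtype).flip) ∘ₗ
      (DirectSum.decomposeLinearEquiv 𝒱).toLinearMap)

theorem ydBraiding_tmul {V W : Type*} [AddCommGroup V] [Module k V] [AddCommGroup W] [Module k W]
    [DistribMulAction Γ W] [SMulCommClass Γ k W]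
    (𝒱 : Γ → Submodule k V) [DirectSum.Decomposition 𝒱] {g : Γ} {v : V} (hv : v ∈ 𝒱 g) (w : W) :
    ydBraiding k W 𝒱 (v ⊗ₜ[k] w) = (g • w) ⊗ₜ[k] v := by
  lift v to 𝒱 g using hv
  simp [ydBraiding, groupAct]

variable {k}
variable [Ring R] [Algebra k R]

/-- The product of the braided tensor product algebra `R ⊗ R`, that is
`(m ⊗ m) (id ⊗ c ⊗ id) : (R ⊗ R) ⊗ (R ⊗ R) → R ⊗ R`. -/
def braidedMul [MulSemiringAction Γ R] [SMulCommClass Γ k R]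
    (𝒢 : Γ → Submodule k R) [DirectSum.Decomposition 𝒢] :
    (R ⊗[k] R) ⊗[k] (R ⊗[k] R) →ₗ[k] R ⊗[k] R :=
  TensorProduct.map (LinearMap.mul' k R) (LinearMap.mul' k R) ∘ₗ
    (TensorProduct.assoc k R R (R ⊗[k] R)).symm.toLinearMap ∘ₗ
    LinearMap.lTensor R
      ((TensorProduct.assoc k R R R).toLinearMap ∘ₗ
        LinearMap.rTensor R (ydBraiding k R 𝒢) ∘ₗ
        (TensorProduct.assoc k R R R).symm.toLinearMap) ∘ₗ
    (TensorProduct.assoc k R R (R ⊗[k] R)).toLinearMap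

theorem braidedMul_tmul [MulSemiringAction Γ R] [SMulCommClass Γ k R]
    (𝒢 : Γ → Submodule k R) [DirectSum.Decomposition 𝒢] (a : R) {b : R} (c d : R) {g : Γ}
    (hb : b ∈ 𝒢 g) :
    braidedMul 𝒢 ((a ⊗ₜ[k] b) ⊗ₜ[k] (c ⊗ₜ[k] d)) = (a * (g • c)) ⊗ₜ[k] (b * d) := by
  simp [braidedMul, ydBraiding_tmul k 𝒢 hb]

open Coalgebra in
/-- `R` is a Hopf algebra in the braided category of Yetter–Drinfeld modules over `k Γ`.
`R` is a `k`-algebra and a `k`-coalgebra with a `k`-linear action of `Γ` by algebra automorphisms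
(so that the unit and the multiplication of `R` are equivariant), and `𝒢` is the decomposition of
`R` given by the coaction. -/
structure IsYetterDrinfeldHopfAlgebra [Coalgebra k R] [MulSemiringAction Γ R] [SMulCommClass Γ k R]
    (𝒢 : Γ → Submodule k R) [DirectSum.Decomposition 𝒢] : Prop where
  /-- `R` is a Yetter–Drinfeld module. -/
  smul_mem : ∀ (g h : Γ) (x : R), x ∈ 𝒢 h → g • x ∈ 𝒢 (g * h * g⁻¹)
  /-- The unit is a morphism. -/
  one_mem : (1 : R) ∈ 𝒢 1
  /-- The multiplication is a morphism. -/
  mul_mem : ∀ (g h : Γ) (x y : R), x ∈ 𝒢 g → y ∈ 𝒢 h → x * y ∈ 𝒢 (g * h)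
  /-- The counit is equivariant. -/
  counit_smul : ∀ (g : Γ) (x : R), counit (R := k) (g • x) = counit (R := k) x
  /-- The counit preserves degrees. -/
  counit_eq_zero : ∀ (g : Γ) (x : R), x ∈ 𝒢 g → g ≠ 1 → counit (R := k) x = 0
  /-- The comultiplication is equivariant. -/
  comul_smul : ∀ (g : Γ) (x : R), comul (R := k) (g • x) =
    TensorProduct.map (groupAct k R g) (groupAct k R g) (comul (R := k) x)
  /-- The comultiplication preserves degrees. -/
  comul_mem : ∀ (g : Γ) (x : R), x ∈ 𝒢 g → comul (R := k) x ∈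
    ⨆ (a : Γ) (b : Γ) (_ : a * b = g), Submodule.map₂ (TensorProduct.mk k R R) (𝒢 a) (𝒢 b)
  /-- The counit is an algebra map. -/
  counit_one : counit (R := k) (1 : R) = 1
  counit_mul : ∀ x y : R, counit (R := k) (x * y) = counit (R := k) x * counit (R := k) y
  /-- The comultiplication is an algebra map to the braided tensor product `R ⊗ R`. -/
  comul_one : comul (R := k) (1 : R) = 1 ⊗ₜ[k] 1
  comul_mul : ∀ x y : R, comul (R := k) (x * y) =
    braidedMul 𝒢 (comul (R := k) x ⊗ₜ[k] comul (R := k) y)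
  /-- There is an antipode: a morphism that is convolution inverse to the identity. -/
  exists_antipode : ∃ S : R →ₗ[k] R,
    (∀ (g : Γ) (x : R), S (g • x) = g • S x) ∧
    (∀ (g : Γ) (x : R), x ∈ 𝒢 g → S x ∈ 𝒢 g) ∧
    LinearMap.mul' k R ∘ₗ S.rTensor R ∘ₗ comul = Algebra.linearMap k R ∘ₗ counit ∧
    LinearMap.mul' k R ∘ₗ S.lTensor R ∘ₗ comul = Algebra.linearMap k R ∘ₗ counit

namespace IsYetterDrinfeldHopfAlgebra

variable [Coalgebra k R] [MulSemiringAction Γ R] [SMulCommClass Γ k R]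
  {𝒢 : Γ → Submodule k R} [DirectSum.Decomposition 𝒢]

/-- The augmentation of `R`: its counit, as an algebra map. -/
def augmentation (hR : IsYetterDrinfeldHopfAlgebra 𝒢) : R →ₐ[k] k :=
  AlgHom.ofLinearMap (Coalgebra.counit (R := k) (A := R)) hR.counit_one hR.counit_mul

/-- The augmentation of the bosonization `R # k Γ`: its counit `ε(r # g) = ε(r)`.

The underlying algebra of `R # k Γ` is the skew group algebra `SkewMonoidAlgebra R Γ`, where
`r # g` is `SkewMonoidAlgebra.single g r` and `(r # g) (s # h) = r (g • s) # g h`. -/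
def bosonizationAugmentation (hR : IsYetterDrinfeldHopfAlgebra 𝒢) :
    SkewMonoidAlgebra R Γ →ₐ[k] k :=
  SkewMonoidAlgebra.liftNCAlgHom hR.augmentation (1 : Γ →* k) (by
    intro x g
    simpa [augmentation] using hR.counit_smul g x)

theorem bosonizationAugmentation_single (hR : IsYetterDrinfeldHopfAlgebra 𝒢) (g : Γ) (r : R) :
    hR.bosonizationAugmentation (SkewMonoidAlgebra.single g r) =
      Coalgebra.counit (R := k) r := by
  change SkewMonoidAlgebra.liftNC _ _ _ = _
  rw [SkewMonoidAlgebra.liftNC_single]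
  simp [augmentation]

end IsYetterDrinfeldHopfAlgebra

end YetterDrinfeld

end

/-! Write `S` for the bosonization and `E` for `H(R, k)`. The proof compares `S` with its subalgebra
`R` and then runs Noether's finiteness argument for invariants of a finite group, with braided
commutativity in place of commutativity.

Restriction. Since `|Γ|` is invertible in `k`, averaging over `Γ` shows that restriction from `Ext`
over `S` to `Ext` over `R` is injective (`mapExactFunctor_restr_injective`). Its image in `E`
contains every `Γ`-invariant class, because the transfer of a class restricts to the sum of its
conjugates (`mem_range_of_invariant`).

Braided commutativity. The comultiplication of `S` maps `R` to `S ⊗ R` (`smashComul`), so an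
`S`-module tensored with an `R`-module is an `R`-module. This bifunctor is exact in each variable,
hence `Ext` classes in its two variables commute up to sign (`mapLeft_comp_mapRight`). Let `W` be
the `S`-module induced from the trivial `R`-module; over `R` it is the direct sum of the twists of
`k`. For `β` in `E` of degree `n`, let `β_g` be the entry of `W ⊗ β` from the summand `1` to the
summand `g`. The class induced from `α` acts diagonally on these summands, as `α` on the first and
as `g · α` on the second. Hence `α β_g = (-1)^(mn) β_g (g · α)` for `α` of degree `m`
(`comp_component`), while the `β_g` add up to `β` (`sum_component`). So `E` is spanned by elements
that commute with all of `E` up to an automorphism from the finite group `G = Γ × {±1}`, the second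
factor taking care of signs.

Noether's argument. If `x` is such an element, then `x ^ |G|` is central. Choose a finite `G`-stable
set `X` of such elements generating `E`. The coefficients of the polynomials `∏ (T - g · x ^ |G|)`
generate a central algebra `B` of invariants over which each `x` in `X` is integral. Words in `X`
can be reordered up to the action of `G`, so `E` is a finite `B`-module
(`exists_subalgebra_finite_of_isTwistedCentral`). Now `B` is Noetherian and lies in the image of
`H(S, k)`. Therefore `H(S, k)`, embedded in `E`, and `H(S, M)`, embedded in the finite `E`-module
`H(R, M)`, are finite over `B` (`finite_of_injective_of_finite_subalgebra`). -/

open CategoryTheory.Limits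

set_option linter.unusedSectionVars false

noncomputable section

/-! ### Exact functors and `Ext` -/

namespace CategoryTheory.Abelian.Ext

universe w' w'' v' v'' u' u''

variable {C : Type u} [Category.{v} C] [Abelian C] [HasExt.{w} C]
  {D : Type u'} [Category.{v'} D] [Abelian D] [HasExt.{w'} D]
  {E : Type u''} [Category.{v''} E] [Abelian E] [HasExt.{w''} E]

/-- The class of a short exact sequence `0 ⟶ X ⟶ Y ⟶ Z ⟶ 0`. -/
def ofShortExact {X Y Z : C} {f : X ⟶ Y} {g : Y ⟶ Z} {w : f ≫ g = 0}
    (h : (ShortComplex.mk f g w).ShortExact) : Ext Z X 1 :=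
  h.extClass

theorem ofShortExact_naturality {X Y Z X' Y' Z' : C} {f : X ⟶ Y} {g : Y ⟶ Z} {w : f ≫ g = 0}
    (h : (ShortComplex.mk f g w).ShortExact) {f' : X' ⟶ Y'} {g' : Y' ⟶ Z'} {w' : f' ≫ g' = 0}
    (h' : (ShortComplex.mk f' g' w').ShortExact) (a : X ⟶ X') (b : Y ⟶ Y') (c : Z ⟶ Z')
    (hab : a ≫ f' = f ≫ b) (hbc : b ≫ g' = g ≫ c) :
    (ofShortExact h).comp (mk₀ a) (add_zero 1) = (mk₀ c).comp (ofShortExact h') (zero_add 1) :=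
  h.extClass_naturality h' { τ₁ := a, τ₂ := b, τ₃ := c, comm₁₂ := hab, comm₂₃ := hbc }

/-- With enough projectives, every `Ext` class is an iterated Yoneda product of a morphism with
classes of short exact sequences. -/
theorem induction_of_enoughProjectives [EnoughProjectives C]
    {motive : ∀ {X Y : C} {n : ℕ}, Ext X Y n → Prop}
    (mk₀ : ∀ {X Y : C} (f : X ⟶ Y), motive (Ext.mk₀ f))
    (ofShortExact_comp : ∀ {K P X : C} {f : K ⟶ P} {g : P ⟶ X} {w : f ≫ g = 0}
      (h : (ShortComplex.mk f g w).ShortExact) {Y : C} {n : ℕ} (β : Ext K Y n),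
      motive β → motive ((ofShortExact h).comp β (add_comm 1 n)))
    {X Y : C} {n : ℕ} (α : Ext X Y n) : motive α := by
  induction n generalizing X with
  | zero =>
    obtain ⟨f, rfl⟩ := (mk₀_bijective X Y).2 α
    exact mk₀ f
  | succ n ih =>
    let P : ProjectivePresentation X := Classical.arbitrary _
    let S := ShortComplex.mk _ _ (kernel.condition P.f)
    have hS : S.ShortExact := { exact := ShortComplex.exact_kernel P.f }
    have : Projective S.X₂ := P.projective
    -- Dimension shifting: the pullback of `α` to the projective cover term vanishes in positive
    -- degree, so `α` comes from the syzygy.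
    obtain ⟨β, rfl⟩ := contravariant_sequence_exact₃ hS Y α (eq_zero_of_projective _) (add_comm 1 n)
    exact ofShortExact_comp hS β (ih β)

section

variable (F : C ⥤ D) [F.Additive] [PreservesFiniteLimits F] [PreservesFiniteColimits F]

theorem map_shortExact {X Y Z : C} {f : X ⟶ Y} {g : Y ⟶ Z} {w : f ≫ g = 0}
    (h : (ShortComplex.mk f g w).ShortExact) :
    (ShortComplex.mk (F.map f) (F.map g) (by rw [← F.map_comp, w, F.map_zero])).ShortExact :=
  h.map_of_exact F

theorem mapExactFunctor_ofShortExact {X Y Z : C} {f : X ⟶ Y} {g : Y ⟶ Z} {w : f ≫ g = 0}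
    (h : (ShortComplex.mk f g w).ShortExact) :
    (ofShortExact h).mapExactFunctor F = ofShortExact (map_shortExact F h) :=
  mapExactFunctor_extClass F h

end

/-- A natural transformation between exact functors commutes with the maps on `Ext`. -/
theorem mapExactFunctor_naturality [EnoughProjectives C] {F F' : C ⥤ D}
    [F.Additive] [PreservesFiniteLimits F] [PreservesFiniteColimits F]
    [F'.Additive] [PreservesFiniteLimits F'] [PreservesFiniteColimits F'] (τ : F ⟶ F')
    {X Y : C} {n : ℕ} (α : Ext X Y n) :
    (α.mapExactFunctor F).comp (mk₀ (τ.app Y)) (add_zero n) =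
      (mk₀ (τ.app X)).comp (α.mapExactFunctor F') (zero_add n) := by
  induction α using induction_of_enoughProjectives with
  | mk₀ f => simp [mapExactFunctor_mk₀]
  | @ofShortExact_comp K P X f g w h Y n β ih =>
    -- `τ` slides past `β` by induction, and past the extension because it gives a morphism between
    -- the two image sequences.
    rw [mapExactFunctor_comp, mapExactFunctor_comp,
      comp_assoc _ _ _ (add_comm 1 n) (add_zero n) (by lia), ih,
      ← comp_assoc _ _ _ (add_zero 1) (zero_add n) (by lia),
      ← comp_assoc _ _ _ (zero_add 1) (add_comm 1 n) (by lia),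
      mapExactFunctor_ofShortExact, mapExactFunctor_ofShortExact,
      ofShortExact_naturality _ (map_shortExact F' h) (τ.app K) (τ.app P) (τ.app X)
        (τ.naturality f).symm (τ.naturality g).symm]

theorem mapExactFunctor_comp_functor [EnoughProjectives C] (F : C ⥤ D) [F.Additive]
    [PreservesFiniteLimits F] [PreservesFiniteColimits F] (G : D ⥤ E) [G.Additive]
    [PreservesFiniteLimits G] [PreservesFiniteColimits G] {X Y : C} {n : ℕ} (α : Ext X Y n) :
    α.mapExactFunctor (F ⋙ G) = (α.mapExactFunctor F).mapExactFunctor G := by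
  induction α using induction_of_enoughProjectives with
  | mk₀ f => simp [mapExactFunctor_mk₀]
  | @ofShortExact_comp K P X f g w h Y n β ih =>
    rw [mapExactFunctor_comp, mapExactFunctor_comp, mapExactFunctor_comp, ih,
      mapExactFunctor_ofShortExact, mapExactFunctor_ofShortExact, mapExactFunctor_ofShortExact]

theorem mapExactFunctor_id [EnoughProjectives C] {X Y : C} {n : ℕ} (α : Ext X Y n) :
    α.mapExactFunctor (𝟭 C) = α := by
  induction α using induction_of_enoughProjectives with
  | mk₀ f => simp [mapExactFunctor_mk₀]
  | @ofShortExact_comp K P X f g w h Y n β ih =>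
    rw [mapExactFunctor_comp, ih, mapExactFunctor_ofShortExact]

theorem comp_zsmul {X Y Z : C} {a b c : ℕ} (α : Ext X Y a) (β : Ext Y Z b) (h : a + b = c) (r : ℤ) :
    α.comp (r • β) h = r • α.comp β h :=
  map_zsmul (bilinearComp X Y Z a b c h α) r β

theorem zsmul_comp {X Y Z : C} {a b c : ℕ} (α : Ext X Y a) (β : Ext Y Z b) (h : a + b = c) (r : ℤ) :
    (r • α).comp β h = r • α.comp β h :=
  congr($(map_zsmul (bilinearComp X Y Z a b c h) r α) β)

open ShortComplex in
/-- The two composites of connecting classes of a `3 × 3` diagram anticommute. -/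
theorem ofShortExact_comp_ofShortExact_anticomm {X₁₁ X₁₂ X₁₃ X₂₁ X₂₂ X₂₃ X₃₁ X₃₂ X₃₃ : C}
    {f₁ : X₁₁ ⟶ X₁₂} {g₁ : X₁₂ ⟶ X₁₃} {f₂ : X₂₁ ⟶ X₂₂} {g₂ : X₂₂ ⟶ X₂₃} {f₃ : X₃₁ ⟶ X₃₂}
    {g₃ : X₃₂ ⟶ X₃₃} {a₁ : X₁₁ ⟶ X₂₁} {b₁ : X₂₁ ⟶ X₃₁} {a₂ : X₁₂ ⟶ X₂₂} {b₂ : X₂₂ ⟶ X₃₂}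
    {a₃ : X₁₃ ⟶ X₂₃} {b₃ : X₂₃ ⟶ X₃₃}
    {w₁ : f₁ ≫ g₁ = 0} (w₂ : f₂ ≫ g₂ = 0) {w₃ : f₃ ≫ g₃ = 0}
    {z₁ : a₁ ≫ b₁ = 0} {z₂ : a₂ ≫ b₂ = 0} {z₃ : a₃ ≫ b₃ = 0}
    (r₁ : (ShortComplex.mk f₁ g₁ w₁).ShortExact) 
    (r₃ : (ShortComplex.mk f₃ g₃ w₃).ShortExact) (c₁ : (ShortComplex.mk a₁ b₁ z₁).ShortExact)
    (c₂ : (ShortComplex.mk a₂ b₂ z₂).ShortExact) (c₃ : (ShortComplex.mk a₃ b₃ z₃).ShortExact)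
    (s₁₁ : a₁ ≫ f₂ = f₁ ≫ a₂) (s₁₂ : a₂ ≫ g₂ = g₁ ≫ a₃) (s₂₁ : b₁ ≫ f₃ = f₂ ≫ b₂)
    (s₂₂ : b₂ ≫ g₃ = g₂ ≫ b₃) :
    (ofShortExact r₃).comp (ofShortExact c₁) (show 1 + 1 = 2 from rfl) =
      - (ofShortExact c₃).comp (ofShortExact r₁) rfl := by
  have : Mono f₃ := r₃.mono_f
  have : Mono a₃ := c₃.mono_f
  have : Mono a₂ := c₂.mono_f
  have : Mono a₁ := c₁.mono_f
  have : Epi b₁ := c₁.epi_g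
  have : Epi b₂ := c₂.epi_g
  have : Epi g₃ := r₃.epi_g
  -- Both composites factor through the kernel `K` of the diagonal map: it projects to `X₃₁` by `p₁`
  -- and to `X₁₃` by `p₂`, and contains `X₂₁` and `X₁₂`.
  let g : X₂₂ ⟶ X₃₃ := b₂ ≫ g₃
  have hg : g = g₂ ≫ b₃ := s₂₂
  have hk : kernel.ι g ≫ b₂ ≫ g₃ = 0 := kernel.condition g
  have hκ : (ShortComplex.mk _ _ (kernel.condition g)).ShortExact :=
    { exact := ShortComplex.exact_kernel g, epi_g := epi_comp _ _ }
  obtain ⟨p₁, hp₁⟩ : ∃ p : kernel g ⟶ X₃₁, p ≫ f₃ = kernel.ι g ≫ b₂ :=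
    ⟨_, r₃.exact.lift_f (kernel.ι g ≫ b₂) (by simpa using hk)⟩
  obtain ⟨p₂, hp₂⟩ : ∃ p : kernel g ⟶ X₁₃, p ≫ a₃ = kernel.ι g ≫ g₂ :=
    ⟨_, c₃.exact.lift_f (kernel.ι g ≫ g₂) (by simpa [← s₂₂] using hk)⟩
  obtain ⟨i₁, hi₁⟩ : ∃ i : X₂₁ ⟶ kernel g, i ≫ kernel.ι g = f₂ :=
    ⟨_, kernel.lift_ι g f₂ (by rw [hg, reassoc_of% w₂, Limits.zero_comp])⟩
  obtain ⟨i₂, hi₂⟩ : ∃ i : X₁₂ ⟶ kernel g, i ≫ kernel.ι g = a₂ :=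
    ⟨_, kernel.lift_ι g a₂ (by rw [reassoc_of% z₂, Limits.zero_comp])⟩
  have i₁p₁ : i₁ ≫ p₁ = b₁ := by
    rw [← cancel_mono f₃, Category.assoc, hp₁, reassoc_of% hi₁, s₂₁]
  have i₁p₂ : i₁ ≫ p₂ = 0 := by
    rw [← cancel_mono a₃, Category.assoc, hp₂, reassoc_of% hi₁, w₂, Limits.zero_comp]
  have i₂p₁ : i₂ ≫ p₁ = 0 := by
    rw [← cancel_mono f₃, Category.assoc, hp₁, reassoc_of% hi₂, z₂, Limits.zero_comp]
  have i₂p₂ : i₂ ≫ p₂ = g₁ := by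
    rw [← cancel_mono a₃, Category.assoc, hp₂, reassoc_of% hi₂, s₁₂]
  have hw : biprod.lift a₁ (-f₁) ≫ biprod.desc i₁ i₂ = 0 := by
    rw [biprod.lift_desc, ← cancel_mono (kernel.ι g), Preadditive.add_comp, Category.assoc,
      Category.assoc, hi₁, hi₂, Preadditive.neg_comp, s₁₁, Limits.zero_comp, add_neg_cancel]
  -- `K` is the sum of `X₂₁` and `X₁₂` with intersection `X₁₁`. The sign needed in front of `f₁` is
  -- the source of the anticommutativity.
  have hQ : (ShortComplex.mk (biprod.lift a₁ (-f₁)) (biprod.desc i₁ i₂) hw).ShortExact :=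
    { mono_f := by
        have : Mono (biprod.lift a₁ (-f₁) ≫ biprod.fst) := by simpa
        exact mono_of_mono (biprod.lift a₁ (-f₁)) (biprod.fst : X₂₁ ⊞ X₁₂ ⟶ X₂₁)
      epi_g := by
        change Epi (biprod.desc i₁ i₂)
        rw [epi_iff_surjective_up_to_refinements]
        intro A y
        obtain ⟨A₁, π₁, _, x₁, h₁⟩ := surjective_up_to_refinements_of_epi b₁ (y ≫ p₁)
        -- Subtracting a lift of `p₁ y` to `X₂₁` leaves something killed by `b₂`, hence coming from
        -- `X₁₂`.
        have h₂ : (π₁ ≫ y ≫ kernel.ι g - x₁ ≫ f₂) ≫ b₂ = 0 := by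
          rw [Preadditive.sub_comp, Category.assoc, Category.assoc, Category.assoc, ← hp₁, ← s₂₁,
            ← reassoc_of% h₁, sub_self]
        obtain ⟨l, hl⟩ : ∃ l : A₁ ⟶ X₁₂, l ≫ a₂ = _ := ⟨_, c₂.exact.lift_f _ h₂⟩
        refine ⟨A₁, π₁, inferInstance, biprod.lift x₁ l, ?_⟩
        rw [← cancel_mono (kernel.ι g)]
        simp only [biprod.lift_desc, Preadditive.add_comp, Category.assoc, hi₁, hi₂, hl]
        abel
      exact := by
        rw [exact_iff_exact_up_to_refinements]
        intro A (x : A ⟶ X₂₁ ⊞ X₁₂) (hx : x ≫ biprod.desc i₁ i₂ = 0)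
        have hx' : x ≫ biprod.fst ≫ i₁ + x ≫ biprod.snd ≫ i₂ = 0 := by
          simpa [biprod.desc_eq] using hx
        have h₁ : (x ≫ biprod.fst) ≫ b₁ = 0 := by
          simpa [i₁p₁, i₂p₁] using congr($hx' ≫ p₁)
        obtain ⟨l, hl⟩ : ∃ l : A ⟶ X₁₁, l ≫ a₁ = _ := ⟨_, c₁.exact.lift_f _ h₁⟩
        refine ⟨A, 𝟙 A, inferInstance, l, ?_⟩
        change 𝟙 A ≫ x = l ≫ biprod.lift a₁ (-f₁)
        rw [Category.id_comp]
        refine biprod.hom_ext _ _ ?_ ?_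
        · simp [hl]
        · rw [← cancel_mono a₂]
          have h₄ := congr($hx' ≫ kernel.ι g)
          simp only [Preadditive.add_comp, Category.assoc, hi₁, hi₂, Limits.zero_comp] at h₄
          simp only [Category.assoc, biprod.lift_snd, Preadditive.comp_neg,
            Preadditive.neg_comp, ← s₁₁, reassoc_of% hl]
          exact eq_neg_of_add_eq_zero_right h₄ }
  -- The two composites are the class of `K ⟶ X₂₂ ⟶ X₃₃` followed by plus or minus the class of
  -- `hQ`: `k₁`, `q₁` give one and `k₂`, `q₂` the other.
  have k₁ : (ofShortExact hκ).comp (mk₀ p₁) (add_zero 1) = ofShortExact r₃ := by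
    rw [ofShortExact_naturality hκ r₃ p₁ b₂ (𝟙 _) hp₁ (by simp [g]), mk₀_id_comp]
  have k₂ : (ofShortExact hκ).comp (mk₀ p₂) (add_zero 1) = ofShortExact c₃ := by
    rw [ofShortExact_naturality hκ c₃ p₂ g₂ (𝟙 _) hp₂ (by simp [hg]), mk₀_id_comp]
  have q₁ : ofShortExact hQ = (mk₀ p₁).comp (ofShortExact c₁) (zero_add 1) := by
    rw [← ofShortExact_naturality hQ c₁ (𝟙 _) biprod.fst p₁ (by simp)
      (by ext <;> simp [i₁p₁, i₂p₁]), comp_mk₀_id]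
  have q₂ : -ofShortExact hQ = (mk₀ p₂).comp (ofShortExact r₁) (zero_add 1) := by
    rw [← ofShortExact_naturality hQ r₁ (-𝟙 _) biprod.snd p₂ (by simp)
      (by ext <;> simp [i₁p₂, i₂p₂]), mk₀_neg, comp_neg, comp_mk₀_id]
  rw [← k₁, ← k₂, comp_assoc _ _ _ (add_zero 1) (zero_add 1) rfl, ← q₁,
    comp_assoc _ _ _ (add_zero 1) (zero_add 1) rfl, ← q₂, comp_neg, neg_neg]

end CategoryTheory.Abelian.Ext

/-! ### Exact bifunctors and `Ext` -/

/-- A bifunctor between abelian categories that is additive and exact in each variable. -/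
class CategoryTheory.Functor.IsExactBifunctor {C D E : Type*} [Category* C] [Category* D]
    [Category* E] [Abelian C] [Abelian D] [Abelian E] (F : C ⥤ D ⥤ E) : Prop where
  additive_obj (X : C) : (F.obj X).Additive
  preservesFiniteLimits_obj (X : C) : PreservesFiniteLimits (F.obj X)
  preservesFiniteColimits_obj (X : C) : PreservesFiniteColimits (F.obj X)
  additive_flip_obj (Y : D) : (F.flip.obj Y).Additive
  preservesFiniteLimits_flip_obj (Y : D) : PreservesFiniteLimits (F.flip.obj Y)
  preservesFiniteColimits_flip_obj (Y : D) : PreservesFiniteColimits (F.flip.obj Y)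

attribute [instance] CategoryTheory.Functor.IsExactBifunctor.additive_obj
  CategoryTheory.Functor.IsExactBifunctor.preservesFiniteLimits_obj
  CategoryTheory.Functor.IsExactBifunctor.preservesFiniteColimits_obj
  CategoryTheory.Functor.IsExactBifunctor.additive_flip_obj
  CategoryTheory.Functor.IsExactBifunctor.preservesFiniteLimits_flip_obj
  CategoryTheory.Functor.IsExactBifunctor.preservesFiniteColimits_flip_obj

namespace CategoryTheory.Abelian.Ext

universe w' w'' v' v'' u' u''

variable {C : Type u} [Category.{v} C] [Abelian C] [HasExt.{w} C]
  {D : Type u'} [Category.{v'} D] [Abelian D] [HasExt.{w'} D]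
  {E : Type u''} [Category.{v''} E] [Abelian E] [HasExt.{w''} E]
  (F : C ⥤ D ⥤ E) [F.IsExactBifunctor]

/-- The action of a bifunctor on `Ext` classes in the first variable. -/
def mapLeft {X X' : C} {n : ℕ} (α : Ext X X' n) (Y : D) :
    Ext ((F.obj X).obj Y) ((F.obj X').obj Y) n :=
  α.mapExactFunctor (F.flip.obj Y)

/-- The action of a bifunctor on `Ext` classes in the second variable. -/
def mapRight (X : C) {Y Y' : D} {n : ℕ} (β : Ext Y Y' n) :
    Ext ((F.obj X).obj Y) ((F.obj X).obj Y') n :=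
  β.mapExactFunctor (F.obj X)

theorem mapLeft_mk₀ {X X' : C} (f : X ⟶ X') (Y : D) :
    mapLeft F (mk₀ f) Y = mk₀ ((F.map f).app Y) :=
  mapExactFunctor_mk₀ _ _

theorem mapRight_mk₀ (X : C) {Y Y' : D} (f : Y ⟶ Y') :
    mapRight F X (mk₀ f) = mk₀ ((F.obj X).map f) :=
  mapExactFunctor_mk₀ _ _

theorem mapLeft_comp {X X' X'' : C} {m n p : ℕ} (α : Ext X X' m) (α' : Ext X' X'' n)
    (h : m + n = p) (Y : D) :
    mapLeft F (α.comp α' h) Y = (mapLeft F α Y).comp (mapLeft F α' Y) h :=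
  mapExactFunctor_comp _ _ _ _

theorem mapRight_comp (X : C) {Y Y' Y'' : D} {m n p : ℕ} (β : Ext Y Y' m) (β' : Ext Y' Y'' n)
    (h : m + n = p) :
    mapRight F X (β.comp β' h) = (mapRight F X β).comp (mapRight F X β') h :=
  mapExactFunctor_comp _ _ _ _

theorem mapLeft_shortExact {X X' X'' : C} {f : X ⟶ X'} {g : X' ⟶ X''} {w : f ≫ g = 0}
    (h : (ShortComplex.mk f g w).ShortExact) (Y : D) :
    (ShortComplex.mk ((F.map f).app Y) ((F.map g).app Y)
      (by rw [← NatTrans.comp_app, ← F.map_comp, w]; exact (F.flip.obj Y).map_zero X X'')).ShortExact :=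
  h.map_of_exact (F.flip.obj Y)

theorem mapLeft_ofShortExact {X X' X'' : C} {f : X ⟶ X'} {g : X' ⟶ X''} {w : f ≫ g = 0}
    (h : (ShortComplex.mk f g w).ShortExact) (Y : D) :
    mapLeft F (ofShortExact h) Y = ofShortExact (mapLeft_shortExact F h Y) :=
  mapExactFunctor_extClass (F.flip.obj Y) h

theorem mapRight_ofShortExact (X : C) {Y Y' Y'' : D} {f : Y ⟶ Y'} {g : Y' ⟶ Y''} {w : f ≫ g = 0}
    (h : (ShortComplex.mk f g w).ShortExact) :
    mapRight F X (ofShortExact h) = ofShortExact (map_shortExact (F.obj X) h) :=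
  mapExactFunctor_extClass (F.obj X) h

theorem mapRight_naturality [EnoughProjectives D] {X X' : C} (f : X ⟶ X') {Y Y' : D} {n : ℕ}
    (β : Ext Y Y' n) :
    (mapRight F X β).comp (mk₀ ((F.map f).app Y')) (add_zero n) =
      (mk₀ ((F.map f).app Y)).comp (mapRight F X' β) (zero_add n) :=
  mapExactFunctor_naturality (F.map f) β

/-- Induction on `β`. A morphism slides past without sign. A bifunctor applied to two short exact
sequences gives a `3 × 3` diagram, so each of the `n` extensions composing `β` contributes one sign.
-/
theorem mapLeft_ofShortExact_comp_mapRight [EnoughProjectives D] {X X' X'' : C} {f : X ⟶ X'}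
    {g : X' ⟶ X''} {w : f ≫ g = 0} (h : (ShortComplex.mk f g w).ShortExact) {Y Y' : D} {n : ℕ}
    (β : Ext Y Y' n) :
    (mapLeft F (ofShortExact h) Y).comp (mapRight F X β) (add_comm 1 n) =
      (-1 : ℤ) ^ n • (mapRight F X'' β).comp (mapLeft F (ofShortExact h) Y') rfl := by
  induction β using induction_of_enoughProjectives with
  | mk₀ g =>
    rw [mapRight_mk₀, mapRight_mk₀, mapLeft_ofShortExact, mapLeft_ofShortExact, pow_zero, one_smul]
    exact ofShortExact_naturality _ _ _ ((F.obj X').map g) _ ((F.map _).naturality g)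
      ((F.map _).naturality g)
  | @ofShortExact_comp K P Y a b z h' Y' n β ih =>
    have key : (mapLeft F (ofShortExact h) Y).comp (mapRight F X (ofShortExact h'))
        (show 1 + 1 = 2 from rfl) =
        - (mapRight F X'' (ofShortExact h')).comp (mapLeft F (ofShortExact h) K) rfl := by
      rw [mapLeft_ofShortExact, mapLeft_ofShortExact, mapRight_ofShortExact, mapRight_ofShortExact]
      exact (neg_eq_iff_eq_neg.mpr <| ofShortExact_comp_ofShortExact_anticomm
        (by rw [← (F.obj X').map_comp, z, (F.obj X').map_zero]) (map_shortExact (F.obj X) h')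
        (map_shortExact (F.obj X'') h') (mapLeft_shortExact F h K) (mapLeft_shortExact F h P)
        (mapLeft_shortExact F h Y) ((F.map f).naturality a).symm ((F.map f).naturality b).symm
        ((F.map g).naturality a).symm ((F.map g).naturality b).symm).symm
    rw [mapRight_comp, mapRight_comp, ← comp_assoc _ _ _ (show 1 + 1 = 2 from rfl)
      (add_comm 1 n) (by lia), key, neg_comp, comp_assoc _ _ _ rfl (add_comm 1 n) (by lia), ih,
      comp_zsmul, ← comp_assoc _ _ _ (add_comm 1 n) rfl (by lia), pow_succ, mul_neg, mul_one,
      neg_smul]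

/-- For an exact bifunctor, `Ext` classes in the two variables commute up to the usual sign. -/
theorem mapLeft_comp_mapRight [EnoughProjectives C] [EnoughProjectives D] {X X' : C} {m : ℕ}
    (α : Ext X X' m) {Y Y' : D} {n p : ℕ} (β : Ext Y Y' n) (h : m + n = p) :
    (mapLeft F α Y).comp (mapRight F X' β) h =
      (-1 : ℤ) ^ (m * n) • (mapRight F X β).comp (mapLeft F α Y') (by lia) := by
  induction α using induction_of_enoughProjectives generalizing p with
  | mk₀ f =>
    obtain rfl : n = p := by lia
    rw [mapLeft_mk₀, mapLeft_mk₀, zero_mul, pow_zero, one_smul]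
    exact (mapRight_naturality F f β).symm
  | @ofShortExact_comp K P Y a b z h' Y' m α ih =>
    -- Moving `β` past `α` costs `(-1) ^ (m * n)` by induction, and past the remaining extension
    -- `(-1) ^ n`.
    rw [mapLeft_comp, mapLeft_comp, comp_assoc _ _ _ (add_comm 1 m) (rfl : m + n = m + n) (by lia),
      ih, comp_zsmul, ← comp_assoc _ _ _ (add_comm 1 n) (add_comm n m) (by lia),
      mapLeft_ofShortExact_comp_mapRight, zsmul_comp, smul_smul,
      comp_assoc _ _ _ rfl (add_comm 1 m) (by lia), ← pow_add, add_mul, one_mul]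

end CategoryTheory.Abelian.Ext

/-! ### Exact functors between module categories -/

namespace ModuleCat

theorem preservesFiniteLimits_and_preservesFiniteColimits {S T : Type*} [Ring S] [Ring T]
    (F : ModuleCat.{u} S ⥤ ModuleCat.{v} T) [F.Additive]
    (hF : ∀ {X Y Z : ModuleCat.{u} S} (f : X ⟶ Y) (g : Y ⟶ Z), Function.Exact f g →
      Function.Exact (F.map f) (F.map g)) :
    PreservesFiniteLimits F ∧ PreservesFiniteColimits F := by
  refine (F.exact_tfae.out 1 3).mp fun S hS => ?_
  rw [ShortComplex.ShortExact.moduleCat_exact_iff_function_exact] at hS ⊢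
  exact hF _ _ hS

section restrictScalars

variable {S T : Type*} [Ring S] [Ring T] (f : S →+* T)

instance preservesFiniteLimits_restrictScalars :
    PreservesFiniteLimits (restrictScalars.{v} f) :=
  (preservesFiniteLimits_and_preservesFiniteColimits _ fun _ _ h => h).1

instance preservesFiniteColimits_restrictScalars :
    PreservesFiniteColimits (restrictScalars.{v} f) :=
  (preservesFiniteLimits_and_preservesFiniteColimits _ fun _ _ h => h).2

instance linear_restrictScalars {k S T : Type*} [Field k] [Ring S] [Ring T] [Algebra k S]
    [Algebra k T] (f : S →ₐ[k] T) : (restrictScalars.{v} (f : S →+* T)).Linear k where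
  map_smul {X Y} g r := by
    ext (x : X)
    change algebraMap k T r • g x = f (algebraMap k S r) • g x
    rw [f.commutes]

/-- Modules obtained by restriction of scalars are isomorphic when the module structures agree. -/
def restrictScalarsIso {S T T' : Type*} [Ring S] [Ring T] [Ring T'] (f : S →+* T) (f' : S →+* T')
    {M : ModuleCat.{v} T} {M' : ModuleCat.{v} T'} (e : M ≃+ M')
    (h : ∀ (s : S) (m : M), e (f s • m) = f' s • e m) :
    (restrictScalars f).obj M ≅ (restrictScalars f').obj M' :=
  (AddEquiv.toLinearEquiv (R := S) (M := ↑((restrictScalars f).obj M))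
    (M₂ := ↑((restrictScalars f').obj M')) e h).toModuleIso

end restrictScalars

end ModuleCat

/-! ### Modules over a skew group algebra -/

namespace SkewMonoidAlgebra

open ModuleCat

variable {k Γ R : Type u} [Field k] [Group Γ] [Ring R] [Algebra k R] [MulSemiringAction Γ R]
  [SMulCommClass Γ k R]

variable (k Γ R) in
/-- The inclusion of `R` in the skew group algebra. -/
def inclusion : R →ₐ[k] SkewMonoidAlgebra R Γ where
  __ := singleOneRingHom
  commutes' _ := rfl

theorem inclusion_apply (r : R) : inclusion k Γ R r = single 1 r := rfl

theorem single_eq_inclusion_mul_of (g : Γ) (r : R) :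
    (single g r : SkewMonoidAlgebra R Γ) = inclusion k Γ R r * of R Γ g := by
  simp [inclusion_apply, of_apply, single_mul_single]

theorem of_mul_inclusion (g : Γ) (r : R) :
    of R Γ g * inclusion k Γ R r = inclusion k Γ R (g • r) * of R Γ g := by
  simp [inclusion_apply, of_apply, single_mul_single]

/-- An additive map is linear over the skew group algebra if it is linear over `R` and
equivariant. -/
theorem map_smul_of_inclusion_of {M N : Type*} [AddCommGroup M] [AddCommGroup N]
    [Module (SkewMonoidAlgebra R Γ) M] [Module (SkewMonoidAlgebra R Γ) N] (f : M →+ N)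
    (h₁ : ∀ (r : R) (m : M), f (inclusion k Γ R r • m) = inclusion k Γ R r • f m)
    (h₂ : ∀ (g : Γ) (m : M), f (of R Γ g • m) = of R Γ g • f m) (a : SkewMonoidAlgebra R Γ)
    (m : M) : f (a • m) = a • f m := by
  induction a using SkewMonoidAlgebra.induction_on with
  | zero => simp
  | single g r => rw [single_eq_inclusion_mul_of (k := k), mul_smul, mul_smul, h₁, h₂]
  | add a b ha hb => rw [add_smul, add_smul, map_add, ha, hb]

variable (k Γ R) in
/-- Restriction from the skew group algebra to `R`. -/
abbrev restr : ModuleCat.{u} (SkewMonoidAlgebra R Γ) ⥤ ModuleCat.{u} R :=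
  restrictScalars (inclusion k Γ R : R →+* SkewMonoidAlgebra R Γ)

variable (k R) in
/-- Twisting an `R`-module by a group element. -/
abbrev twist (g : Γ) : ModuleCat.{u} R ⥤ ModuleCat.{u} R :=
  restrictScalars ((MulSemiringAction.toAlgHom k R g⁻¹ : R →ₐ[k] R) : R →+* R)

/-- The underlying group of the module induced from `R` to the skew group algebra. -/
def Induced (Γ M : Type*) : Type _ := Γ → M

/-! ### The module structure of the induced module -/

namespace Induced

variable (M : Type u) [AddCommGroup M]

instance : AddCommGroup (Induced Γ M) := inferInstanceAs (AddCommGroup (Γ → M))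

variable [Module R M]

variable (Γ R) in
/-- The action of `R` on the induced module. -/
def smulHom : R →+* AddMonoid.End (Induced Γ M) where
  toFun r :=
    -- The value `f u` stands for `u ⊗ f u`, and `r u = u (u⁻¹ • r)` in the skew group algebra.
    { toFun := fun f u => (u⁻¹ • r) • f u
      map_zero' := funext fun u => smul_zero _
      map_add' := fun f f' => funext fun u => smul_add _ _ _ }
  map_one' := AddMonoidHom.ext fun f => funext fun u => by
    change (u⁻¹ • (1 : R)) • f u = f u
    rw [smul_one, one_smul]
  map_mul' r s := AddMonoidHom.ext fun f => funext fun u => by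
    change (u⁻¹ • (r * s)) • f u = (u⁻¹ • r) • (u⁻¹ • s) • f u
    rw [smul_mul', mul_smul]
  map_zero' := AddMonoidHom.ext fun f => funext fun u => by
    change (u⁻¹ • (0 : R)) • f u = 0
    rw [smul_zero, zero_smul]
  map_add' r s := AddMonoidHom.ext fun f => funext fun u => by
    change (u⁻¹ • (r + s)) • f u = (u⁻¹ • r) • f u + (u⁻¹ • s) • f u
    rw [smul_add, add_smul]

variable (Γ) in
/-- The action of the group on the induced module. -/
def translateHom : Γ →* AddMonoid.End (Induced Γ M) where
  toFun g :=
    { toFun := fun f u => f (g⁻¹ * u)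
      map_zero' := rfl
      map_add' := fun _ _ => rfl }
  map_one' := AddMonoidHom.ext fun f => funext fun u => by
    change f (1⁻¹ * u) = f u
    rw [inv_one, one_mul]
  map_mul' g h := AddMonoidHom.ext fun f => funext fun u => by
    change f ((g * h)⁻¹ * u) = f (h⁻¹ * (g⁻¹ * u))
    rw [mul_inv_rev, mul_assoc]

instance : Module (SkewMonoidAlgebra R Γ) (Induced Γ M) :=
  Module.compHom _ (liftNCRingHom (smulHom Γ R M) (translateHom Γ M) (by
    intro r g
    refine AddMonoidHom.ext fun f => funext fun u => ?_
    change (u⁻¹ • g • r) • f (g⁻¹ * u) = ((g⁻¹ * u)⁻¹ • r) • f (g⁻¹ * u)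
    rw [mul_inv_rev, inv_inv, mul_smul]))

variable {M}

theorem single_smul_apply (g : Γ) (r : R) (f : Induced Γ M) (u : Γ) :
    ((single g r : SkewMonoidAlgebra R Γ) • f) u = (u⁻¹ • r) • f (g⁻¹ * u) := by
  change liftNC (smulHom Γ R M : R →+ _) (translateHom Γ M) (single g r) f u = _
  rw [liftNC_single]
  rfl

theorem inclusion_smul_apply (r : R) (f : Induced Γ M) (u : Γ) :
    (inclusion k Γ R r • f) u = (u⁻¹ • r) • f u := by
  rw [inclusion_apply, single_smul_apply, inv_one, one_mul]

theorem of_smul_apply (g : Γ) (f : Induced Γ M) (u : Γ) :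
    (of R Γ g • f) u = f (g⁻¹ * u) := by
  rw [of_apply, single_smul_apply, smul_one, one_smul]

end Induced

variable (k Γ R) in
/-- Induction from `R` to the skew group algebra, on morphisms. -/
def indMap {M N : Type u} [AddCommGroup M] [AddCommGroup N] [Module R M] [Module R N]
    (φ : M →ₗ[R] N) : Induced Γ M →ₗ[SkewMonoidAlgebra R Γ] Induced Γ N :=
  let ψ : Induced Γ M →+ Induced Γ N :=
    { toFun := fun f u => φ (f u)
      map_zero' := funext fun _ => map_zero φ
      map_add' := fun _ _ => funext fun _ => map_add φ _ _ }
  { ψ with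
    map_smul' := map_smul_of_inclusion_of (k := k) ψ
      (fun r f => funext fun u =>
        (congrArg φ (Induced.inclusion_smul_apply (k := k) r f u)).trans <|
          (map_smul φ _ _).trans (Induced.inclusion_smul_apply (k := k) r (ψ f) u).symm)
      (fun g f => funext fun u =>
        (congrArg φ (Induced.of_smul_apply g f u)).trans
          (Induced.of_smul_apply g (ψ f) u).symm) }

variable (k Γ R) in
/-- Induction from `R` to the skew group algebra. -/
def ind : ModuleCat.{u} R ⥤ ModuleCat.{u} (SkewMonoidAlgebra R Γ) where
  obj M := ModuleCat.of _ (Induced Γ M)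
  map φ := ModuleCat.ofHom (indMap k Γ R φ.hom)
  map_id _ := rfl
  map_comp _ _ := rfl

instance : (ind k Γ R).Additive where
  map_add {_ _ _ _} := rfl

theorem exact_ind_map {X Y Z : ModuleCat.{u} R} (f : X ⟶ Y) (g : Y ⟶ Z) (h : Function.Exact f g) :
    Function.Exact ((ind k Γ R).map f) ((ind k Γ R).map g) := by
  intro (y : Induced Γ Y)
  constructor
  · intro hy
    have (u : Γ) : ∃ x, f x = y u := (h (y u)).1 (congrFun hy u)
    choose x hx using this
    exact ⟨x, funext hx⟩
  · rintro ⟨x, rfl⟩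
    exact funext fun u => (h _).2 ⟨x u, rfl⟩

instance : PreservesFiniteLimits (ind k Γ R) :=
  (preservesFiniteLimits_and_preservesFiniteColimits _ exact_ind_map).1

instance : PreservesFiniteColimits (ind k Γ R) :=
  (preservesFiniteLimits_and_preservesFiniteColimits _ exact_ind_map).2

variable (k R) in
/-- The inclusion of a summand of an induced module. -/
def indInl [DecidableEq Γ] (u : Γ) : twist k R u ⟶ ind k Γ R ⋙ restr k Γ R where
  app M := ConcreteCategory.ofHom (C := ModuleCat R)
    { toFun := fun m : M => (Pi.single u m : Γ → M)
      map_add' := fun m m' => Pi.single_add _ _ _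
      map_smul' := fun r (m : M) => funext fun v => by
        refine Eq.trans ?_ (Induced.inclusion_smul_apply (k := k) r (Pi.single u m : Γ → M) v).symm
        change (Pi.single u ((u⁻¹ • r) • m) : Γ → M) v = (v⁻¹ • r) • (Pi.single u m : Γ → M) v
        by_cases hv : v = u
        · subst hv; simp
        · simp [hv] }
  naturality M N φ := by
    ext (m : M)
    refine funext fun v => ?_
    change (Pi.single u (φ m) : Γ → N) v = φ ((Pi.single u m : Γ → M) v)
    by_cases hv : v = u
    · subst hv; simp
    · simp [hv]

variable (k R) in
/-- The projection of an induced module to a summand. -/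
def indProj (u : Γ) : ind k Γ R ⋙ restr k Γ R ⟶ twist k R u where
  app M := ConcreteCategory.ofHom (C := ModuleCat R)
    { toFun := fun f : Γ → M => f u
      map_add' := fun _ _ => rfl
      map_smul' := fun r (f : Γ → M) =>
        Induced.inclusion_smul_apply (k := k) (M := M) r (f : Induced Γ M) u }
  naturality _ _ _ := rfl

variable (k Γ R) in
/-- The unit map from a module to the module induced from its restriction. -/
def coindUnit : 𝟭 (ModuleCat.{u} (SkewMonoidAlgebra R Γ)) ⟶ restr k Γ R ⋙ ind k Γ R where
  app M :=
    let ψ : M →+ Induced Γ ((restr k Γ R).obj M) :=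
      { toFun := fun m => (fun u => of R Γ u⁻¹ • m : Γ → M)
        map_zero' := funext fun u => smul_zero _
        map_add' := fun m m' => funext fun u => smul_add _ _ _ }
    ConcreteCategory.ofHom (C := ModuleCat (SkewMonoidAlgebra R Γ))
    { ψ with
      map_smul' := map_smul_of_inclusion_of (k := k) ψ
        (fun r m => funext fun u => by
          refine Eq.trans ?_ (Induced.inclusion_smul_apply (k := k) r (ψ m) u).symm
          change of R Γ u⁻¹ • inclusion k Γ R r • m =
            inclusion k Γ R (u⁻¹ • r) • of R Γ u⁻¹ • m
          rw [smul_smul, smul_smul, of_mul_inclusion])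
        (fun g m => funext fun u => by
          refine Eq.trans ?_ (Induced.of_smul_apply g (ψ m) u).symm
          change of R Γ u⁻¹ • of R Γ g • m = of R Γ (g⁻¹ * u)⁻¹ • m
          rw [smul_smul, ← map_mul, mul_inv_rev, inv_inv]) }
  naturality M N φ := by
    ext (m : M)
    refine funext fun u => ?_
    exact (map_smul φ.hom (of R Γ u⁻¹) m).symm

variable (k Γ R) in
/-- The counit map from the module induced from the restriction of a module. -/
def indCounit [Fintype Γ] :
    restr k Γ R ⋙ ind k Γ R ⟶ 𝟭 (ModuleCat.{u} (SkewMonoidAlgebra R Γ)) where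
  app M :=
    let ψ : Induced Γ ((restr k Γ R).obj M) →+ M :=
      { toFun := fun f => ∑ u, of R Γ u • (show M from f u)
        map_zero' := Finset.sum_eq_zero fun u _ => smul_zero (A := M) (of R Γ u)
        map_add' := fun f f' => by
          rw [← Finset.sum_add_distrib]
          exact Finset.sum_congr rfl fun u _ => smul_add _ _ _ }
    ConcreteCategory.ofHom (C := ModuleCat (SkewMonoidAlgebra R Γ))
    { ψ with
      map_smul' := map_smul_of_inclusion_of (k := k) ψ
        (fun r f => by
          refine Eq.trans (Finset.sum_congr rfl fun u _ => ?_) Finset.smul_sum.symm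
          refine (congrArg (fun m : M => of R Γ u • m)
            (Induced.inclusion_smul_apply (k := k) r f u)).trans ?_
          change of R Γ u • inclusion k Γ R (u⁻¹ • r) • (show M from f u) =
            inclusion k Γ R r • of R Γ u • (show M from f u)
          rw [smul_smul, smul_smul, of_mul_inclusion, smul_inv_smul])
        (fun g f => by
          refine Eq.trans ?_ Finset.smul_sum.symm
          refine Fintype.sum_equiv (Equiv.mulLeft g⁻¹) _ _ fun u => ?_
          refine (congrArg (fun m : M => of R Γ u • m) (Induced.of_smul_apply g f u)).trans ?_
          change of R Γ u • (show M from f (g⁻¹ * u)) =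
            of R Γ g • of R Γ (g⁻¹ * u) • (show M from f (g⁻¹ * u))
          rw [smul_smul, ← map_mul, mul_inv_cancel_left]) }
  naturality M N φ := by
    refine ModuleCat.hom_ext (LinearMap.ext fun (f : Γ → M) => ?_)
    refine Eq.trans ?_ (_root_.map_sum φ.hom _ _).symm
    exact Finset.sum_congr rfl fun u _ => (map_smul φ.hom (of R Γ u) (f u)).symm

/-- Maschke's averaging: each `u` contributes `u u⁻¹ m = m`. -/
theorem coindUnit_app_comp_indCounit_app [Fintype Γ] (M : ModuleCat.{u} (SkewMonoidAlgebra R Γ)) :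
    (coindUnit k Γ R).app M ≫ (indCounit k Γ R).app M = (Fintype.card Γ : k) • 𝟙 M := by
  ext (m : M)
  change ∑ u : Γ, of R Γ u • of R Γ u⁻¹ • m = algebraMap k (SkewMonoidAlgebra R Γ) _ • m
  simp [smul_smul, Nat.cast_smul_eq_nsmul]

-- Restricting and then inducing a class, and composing with the unit and the counit, multiplies it
-- by `|Γ|`, which is invertible in characteristic zero. So a class that restricts to zero is zero.
variable (k R) in
theorem mapExactFunctor_restr_injective [Finite Γ] [CharZero k]
    {X Y : ModuleCat.{u} (SkewMonoidAlgebra R Γ)} {n : ℕ} :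
    Function.Injective (Ext.mapExactFunctor (restr k Γ R) (X := X) (Y := Y) (n := n)) := by
  cases nonempty_fintype Γ
  refine (injective_iff_map_eq_zero ((restr k Γ R).mapExtAddHom X Y n)).2 fun α hα => ?_
  replace hα : α.mapExactFunctor (restr k Γ R) = 0 := hα
  have h₁ := Ext.mapExactFunctor_naturality (coindUnit k Γ R) α
  rw [Ext.mapExactFunctor_comp_functor, hα, Ext.mapExactFunctor_zero, Ext.comp_zero,
    Ext.mapExactFunctor_id] at h₁
  have h₂ : α.comp (Ext.mk₀ ((coindUnit k Γ R).app Y ≫ (indCounit k Γ R).app Y)) (add_zero n) = 0 := by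
    rw [← Ext.mk₀_comp_mk₀, ← Ext.comp_assoc _ _ _ (add_zero n) (add_zero 0) (by lia)]
    exact (congrArg (fun β => Ext.comp β (Ext.mk₀ ((indCounit k Γ R).app Y)) (add_zero n)) h₁).trans
      (Ext.zero_comp _ _ _ _ _)
  rw [coindUnit_app_comp_indCounit_app, ← Ext.smul_eq_comp_mk₀] at h₂
  exact (smul_eq_zero.1 h₂).resolve_left (Nat.cast_ne_zero.2 Fintype.card_ne_zero)

end SkewMonoidAlgebra

/-! ### The tensor product of modules over two algebras -/

namespace ModuleCat

open scoped ModuleCat.Algebra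

variable {k A R : Type u} [Field k] [Ring A] [Algebra k A] [Ring R] [Algebra k R]

variable (k) in
/-- The action of `A ⊗ R` on `X ⊗ Y`. -/
def tensorAct (X : ModuleCat.{u} A) (Y : ModuleCat.{u} R) :
    A ⊗[k] R →ₐ[k] Module.End k (X ⊗[k] Y) :=
  (Module.endTensorEndAlgHom (R := k) (A := k)).comp
    (Algebra.TensorProduct.map (Algebra.lsmul k k X) (Algebra.lsmul k k Y))

theorem tensorAct_tmul (X : ModuleCat.{u} A) (Y : ModuleCat.{u} R) (a : A) (r : R) (x : X) (y : Y) :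
    tensorAct k X Y (a ⊗ₜ r) (x ⊗ₜ y) = (a • x) ⊗ₜ (r • y) := rfl

theorem map_tensorAct {X X' : ModuleCat.{u} A} {Y Y' : ModuleCat.{u} R} (f : X →ₗ[A] X')
    (g : Y →ₗ[R] Y') (z : A ⊗[k] R) (t : X ⊗[k] Y) :
    TensorProduct.map (f.restrictScalars k) (g.restrictScalars k) (tensorAct k X Y z t) =
      tensorAct k X' Y' z (TensorProduct.map (f.restrictScalars k) (g.restrictScalars k) t) := by
  induction z with
  | zero => simp
  | add z z' hz hz' => rw [map_add, map_add, LinearMap.add_apply, LinearMap.add_apply, map_add, hz, hz']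
  | tmul a r =>
    induction t with
    | zero => simp
    | add t t' ht ht' => rw [map_add, map_add, map_add, map_add, ht, ht']
    | tmul x y => simp [tensorAct_tmul]

/-- The tensor product `X ⊗ Y` as a module along an algebra map `Δ : R → A ⊗ R`. -/
def TensorObj (_ : R →ₐ[k] A ⊗[k] R) (X : ModuleCat.{u} A) (Y : ModuleCat.{u} R) : Type u :=
  X ⊗[k] Y

variable (Δ : R →ₐ[k] A ⊗[k] R)

instance (X : ModuleCat.{u} A) (Y : ModuleCat.{u} R) : AddCommGroup (TensorObj Δ X Y) :=
  inferInstanceAs (AddCommGroup (X ⊗[k] Y))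

instance (X : ModuleCat.{u} A) (Y : ModuleCat.{u} R) : Module R (TensorObj Δ X Y) :=
  letI : Module (Module.End k (X ⊗[k] Y)) (TensorObj Δ X Y) :=
    inferInstanceAs (Module (Module.End k (X ⊗[k] Y)) (X ⊗[k] Y))
  Module.compHom _ (((tensorAct k X Y).comp Δ : R →ₐ[k] Module.End k (X ⊗[k] Y)) :
    R →+* Module.End k (X ⊗[k] Y))

/-- The tensor product of two linear maps. -/
def tensorMap {X X' : ModuleCat.{u} A} {Y Y' : ModuleCat.{u} R} (f : X ⟶ X') (g : Y ⟶ Y') :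
    TensorObj Δ X Y →ₗ[R] TensorObj Δ X' Y' where
  toFun := TensorProduct.map (f.hom.restrictScalars k) (g.hom.restrictScalars k)
  map_add' := map_add _
  map_smul' r t := map_tensorAct f.hom g.hom (Δ r) t

/-- The bifunctor `(X, Y) ↦ X ⊗ Y`. -/
def tensorBifunctor : ModuleCat.{u} A ⥤ ModuleCat.{u} R ⥤ ModuleCat.{u} R where
  obj X :=
    { obj Y := ModuleCat.of R (TensorObj Δ X Y)
      map g := ModuleCat.ofHom (tensorMap Δ (𝟙 X) g)
      map_id Y := ModuleCat.hom_ext <| LinearMap.ext fun (t : X ⊗[k] Y) =>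
        LinearMap.congr_fun (TensorProduct.map_id (R := k) (M := X) (N := Y)) t
      map_comp {Y _ _} g g' := ModuleCat.hom_ext <| LinearMap.ext fun (t : X ⊗[k] Y) =>
        LinearMap.congr_fun (TensorProduct.map_comp (LinearMap.id (R := k) (M := X))
          (g'.hom.restrictScalars k) (LinearMap.id (R := k) (M := X)) (g.hom.restrictScalars k)) t }
  map {X X'} f :=
    { app Y := ModuleCat.ofHom (tensorMap Δ f (𝟙 Y))
      naturality {Y Y'} g := ModuleCat.hom_ext <| LinearMap.ext fun (t : X ⊗[k] Y) =>
        (LinearMap.congr_fun (TensorProduct.map_comp (f.hom.restrictScalars k)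
          (LinearMap.id (R := k) (M := Y')) (LinearMap.id (R := k) (M := X))
          (g.hom.restrictScalars k)) t).symm.trans
        (LinearMap.congr_fun (TensorProduct.map_comp (LinearMap.id (R := k) (M := X'))
          (g.hom.restrictScalars k) (f.hom.restrictScalars k)
          (LinearMap.id (R := k) (M := Y))) t) }
  map_id X := NatTrans.ext <| funext fun Y => ModuleCat.hom_ext <|
    LinearMap.ext fun (t : X ⊗[k] Y) =>
      LinearMap.congr_fun (TensorProduct.map_id (R := k) (M := X) (N := Y)) t
  map_comp {X _ _} f f' := NatTrans.ext <| funext fun Y => ModuleCat.hom_ext <|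
    LinearMap.ext fun (t : X ⊗[k] Y) =>
      LinearMap.congr_fun (TensorProduct.map_comp (f'.hom.restrictScalars k)
        (LinearMap.id (R := k) (M := Y)) (f.hom.restrictScalars k)
        (LinearMap.id (R := k) (M := Y))) t

instance additive_tensorBifunctor_obj (X : ModuleCat.{u} A) :
    ((tensorBifunctor Δ).obj X).Additive where
  map_add {Y _ g g'} := ModuleCat.hom_ext <| LinearMap.ext fun (t : X ⊗[k] Y) =>
    LinearMap.congr_fun (TensorProduct.map_add_right (LinearMap.id (R := k) (M := X))
      (g.hom.restrictScalars k) (g'.hom.restrictScalars k)) t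

instance additive_tensorBifunctor_flip_obj (Y : ModuleCat.{u} R) :
    ((tensorBifunctor Δ).flip.obj Y).Additive where
  map_add {X _ f f'} := ModuleCat.hom_ext <| LinearMap.ext fun (t : X ⊗[k] Y) =>
    LinearMap.congr_fun (TensorProduct.map_add_left (f.hom.restrictScalars k)
      (f'.hom.restrictScalars k) (LinearMap.id (R := k) (M := Y))) t

theorem exact_tensorBifunctor_obj_map (X : ModuleCat.{u} A) {Y Y' Y'' : ModuleCat.{u} R}
    (g : Y ⟶ Y') (g' : Y' ⟶ Y'') (h : Function.Exact g g') :
    Function.Exact (((tensorBifunctor Δ).obj X).map g) (((tensorBifunctor Δ).obj X).map g') :=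
  Module.Flat.lTensor_exact (R := k) (M := X) (f := g.hom.restrictScalars k)
    (g := g'.hom.restrictScalars k) h

theorem exact_tensorBifunctor_flip_obj_map (Y : ModuleCat.{u} R) {X X' X'' : ModuleCat.{u} A}
    (f : X ⟶ X') (f' : X' ⟶ X'') (h : Function.Exact f f') :
    Function.Exact (((tensorBifunctor Δ).flip.obj Y).map f)
      (((tensorBifunctor Δ).flip.obj Y).map f') :=
  Module.Flat.rTensor_exact (R := k) (M := Y) (f := f.hom.restrictScalars k)
    (g := f'.hom.restrictScalars k) h

instance : (tensorBifunctor Δ).IsExactBifunctor where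
  additive_obj _ := inferInstance
  preservesFiniteLimits_obj X := (preservesFiniteLimits_and_preservesFiniteColimits _
    (exact_tensorBifunctor_obj_map Δ X)).1
  preservesFiniteColimits_obj X := (preservesFiniteLimits_and_preservesFiniteColimits _
    (exact_tensorBifunctor_obj_map Δ X)).2
  additive_flip_obj _ := inferInstance
  preservesFiniteLimits_flip_obj Y := (preservesFiniteLimits_and_preservesFiniteColimits _
    (exact_tensorBifunctor_flip_obj_map Δ Y)).1
  preservesFiniteColimits_flip_obj Y := (preservesFiniteLimits_and_preservesFiniteColimits _
    (exact_tensorBifunctor_flip_obj_map Δ Y)).2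

/-- An additive equivalence with the base field under which the algebra acts by scalars is
linear over the field. -/
def linearEquivOfAugmentation (ε : A →ₐ[k] k) {X : ModuleCat.{u} A} (e : X ≃+ k)
    (he : ∀ (a : A) (x : X), e (a • x) = ε a * e x) : X ≃ₗ[k] k where
  __ := e
  map_smul' c x := by
    refine (he (algebraMap k A c) x).trans ?_
    rw [ε.commutes]
    rfl

/-! ### Unit constraints of the tensor product -/

section Unit

variable (ε : A →ₐ[k] k) {X : ModuleCat.{u} A} (e : X ≃+ k)
  (he : ∀ (a : A) (x : X), e (a • x) = ε a * e x)

/-- The isomorphism `X ⊗ Y ≅ Y` for `X` isomorphic to the base field. -/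
def lidOfAugmentation (Y : ModuleCat.{u} R) : X ⊗[k] Y ≃ₗ[k] Y :=
  LinearEquiv.rTensor Y (linearEquivOfAugmentation ε e he) ≪≫ₗ TensorProduct.lid k Y

/-- The isomorphism `Y ⊗ X ≅ Y` for `X` isomorphic to the base field. -/
def ridOfAugmentation (Y : ModuleCat.{u} R) : Y ⊗[k] X ≃ₗ[k] Y :=
  LinearEquiv.lTensor Y (linearEquivOfAugmentation ε e he) ≪≫ₗ TensorProduct.rid k Y

theorem lidOfAugmentation_tmul (Y : ModuleCat.{u} R) (x : X) (y : Y) :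
    lidOfAugmentation ε e he Y (x ⊗ₜ y) = e x • y := rfl

theorem ridOfAugmentation_tmul (Y : ModuleCat.{u} R) (x : X) (y : Y) :
    ridOfAugmentation ε e he Y (y ⊗ₜ x) = e x • y := rfl

/-- With `z = Δ r`, this turns a counit identity for `Δ` into `R`-linearity of the unit constraint.
-/
theorem lidOfAugmentation_tensorAct (Y : ModuleCat.{u} R) (z : A ⊗[k] R) (t : X ⊗[k] Y) :
    lidOfAugmentation ε e he Y (tensorAct k X Y z t) =
      Algebra.TensorProduct.lid k R (Algebra.TensorProduct.map ε (AlgHom.id k R) z) •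
        lidOfAugmentation ε e he Y t := by
  induction z with
  | zero => simp
  | add z z' hz hz' => rw [map_add, LinearMap.add_apply, map_add, hz, hz', map_add, map_add, add_smul]
  | tmul a r =>
    induction t with
    | zero => simp
    | add t t' ht ht' => rw [map_add, map_add, ht, ht', map_add, smul_add]
    | tmul c y =>
      rw [tensorAct_tmul, lidOfAugmentation_tmul, lidOfAugmentation_tmul, he]
      simp [mul_smul, smul_comm r]

theorem ridOfAugmentation_tensorAct (Y : ModuleCat.{u} R) (z : R ⊗[k] A) (t : Y ⊗[k] X) :
    ridOfAugmentation ε e he Y (tensorAct k Y X z t) =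
      Algebra.TensorProduct.rid k k R (Algebra.TensorProduct.map (AlgHom.id k R) ε z) •
        ridOfAugmentation ε e he Y t := by
  induction z with
  | zero => simp
  | add z z' hz hz' => rw [map_add, LinearMap.add_apply, map_add, hz, hz', map_add, map_add, add_smul]
  | tmul a r =>
    induction t with
    | zero => simp
    | add t t' ht ht' => rw [map_add, map_add, ht, ht', map_add, smul_add]
    | tmul c y =>
      rw [tensorAct_tmul, ridOfAugmentation_tmul, ridOfAugmentation_tmul, he]
      simp [mul_smul, smul_comm a]

theorem lidOfAugmentation_lTensor {Y Y' : ModuleCat.{u} R} (g : Y ⟶ Y') (t : X ⊗[k] Y) :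
    lidOfAugmentation ε e he Y' (TensorProduct.map LinearMap.id (g.hom.restrictScalars k) t) =
      g (lidOfAugmentation ε e he Y t) := by
  induction t with
  | zero => simp
  | add t t' ht ht' => rw [map_add, map_add, ht, ht', map_add, map_add]
  | tmul c y =>
    rw [TensorProduct.map_tmul, lidOfAugmentation_tmul, lidOfAugmentation_tmul]
    exact (map_smul (g.hom.restrictScalars k) (e c) y).symm

theorem ridOfAugmentation_rTensor {Y Y' : ModuleCat.{u} R} (g : Y ⟶ Y') (t : Y ⊗[k] X) :
    ridOfAugmentation ε e he Y' (TensorProduct.map (g.hom.restrictScalars k) LinearMap.id t) =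
      g (ridOfAugmentation ε e he Y t) := by
  induction t with
  | zero => simp
  | add t t' ht ht' => rw [map_add, map_add, ht, ht', map_add, map_add]
  | tmul y c =>
    rw [TensorProduct.map_tmul, ridOfAugmentation_tmul, ridOfAugmentation_tmul]
    exact (map_smul (g.hom.restrictScalars k) (e c) y).symm

/-- The left unit constraint `X ⊗ Y ⟶ Y` for `X` isomorphic to the trivial module. -/
def tensorLeftUnit
    (h : ∀ r, Algebra.TensorProduct.lid k R
      (Algebra.TensorProduct.map ε (AlgHom.id k R) (Δ r)) = r) :
    (tensorBifunctor Δ).obj X ⟶ 𝟭 (ModuleCat.{u} R) where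
  app Y := ModuleCat.ofHom (X := TensorObj Δ X Y) (Y := Y)
    { toFun := lidOfAugmentation ε e he Y
      map_add' := map_add (lidOfAugmentation ε e he Y)
      map_smul' := fun r t => (lidOfAugmentation_tensorAct ε e he Y (Δ r) t).trans
        (congrArg (fun s : R => s • lidOfAugmentation ε e he Y t) (h r)) }
  naturality _ _ g := ModuleCat.hom_ext <| LinearMap.ext fun t =>
    lidOfAugmentation_lTensor ε e he g t

end Unit

/-- The right unit constraint `X ⊗ Y ≅ X` for `Y` isomorphic to the trivial module. -/
def tensorRightUnit (ε : R →ₐ[k] k) {Y : ModuleCat.{u} R} (e : Y ≃+ k)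
    (he : ∀ (r : R) (y : Y), e (r • y) = ε r * e y) (ι : R →ₐ[k] A)
    (h : ∀ r, Algebra.TensorProduct.rid k k A
      (Algebra.TensorProduct.map (AlgHom.id k A) ε (Δ r)) = ι r) :
    (tensorBifunctor Δ).flip.obj Y ≅ restrictScalars.{u} (ι : R →+* A) :=
  NatIso.ofComponents
    (fun X => (AddEquiv.toLinearEquiv (R := R) (M := TensorObj Δ X Y)
      (M₂ := ↑((restrictScalars.{u} (ι : R →+* A)).obj X))
      (ridOfAugmentation ε e he X).toAddEquiv
      fun r t => (ridOfAugmentation_tensorAct ε e he X (Δ r) t).trans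
        (congrArg (fun a : A => a • ridOfAugmentation ε e he X t) (h r))).toModuleIso)
    fun f => ModuleCat.hom_ext <| LinearMap.ext fun t => ridOfAugmentation_rTensor ε e he f t

/-- The trivial module restricts to the trivial module. -/
def restrictScalarsTrivialModule (ε : A →ₐ[k] k) (ι : R →ₐ[k] A) (ε' : R →ₐ[k] k)
    (h : ε.comp ι = ε') :
    (restrictScalars.{u} (ι : R →+* A)).obj (trivialModule ε) ≅ trivialModule ε' :=
  restrictScalarsIso (ι : R →+* A) (ε' : R →+* k) (M := trivialModule ε) (M' := ModuleCat.of k k)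
    (AddEquiv.refl k) fun r (c : k) => congrArg (· * c) (AlgHom.congr_fun h r)

/-- After identification with `k`, both sides multiply two scalars. This compatibility is what makes
tensoring a class with the trivial module return the class. -/
theorem tensorLeftUnit_app_eq (ε : A →ₐ[k] k) (ι : R →ₐ[k] A) (ε' : R →ₐ[k] k)
    (hl : ∀ r, Algebra.TensorProduct.lid k R
      (Algebra.TensorProduct.map ε (AlgHom.id k R) (Δ r)) = r)
    (hr : ∀ r, Algebra.TensorProduct.rid k k A
      (Algebra.TensorProduct.map (AlgHom.id k A) ε' (Δ r)) = ι r)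
    {X : ModuleCat.{u} A} (e : X ≃+ k) (he : ∀ (a : A) (x : X), e (a • x) = ε a * e x)
    {Y : ModuleCat.{u} R} (e' : Y ≃+ k) (he' : ∀ (r : R) (y : Y), e' (r • y) = ε' r * e' y)
    (κ : (restrictScalars.{u} (ι : R →+* A)).obj X ⟶ Y)
    (hκ : ∀ x : X, e' (κ x) = e x) :
    (tensorLeftUnit Δ ε e he hl).app Y = (tensorRightUnit Δ ε' e' he' ι hr).hom.app X ≫ κ := by
  refine ModuleCat.hom_ext <| LinearMap.ext fun t => ?_
  change lidOfAugmentation ε e he Y t = κ (ridOfAugmentation ε' e' he' X t)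
  let t' : X ⊗[k] Y := t
  change lidOfAugmentation ε e he Y t' = κ (ridOfAugmentation ε' e' he' X t')
  induction t' with
  | zero => exact (map_zero _).trans (((congrArg κ (map_zero _)).trans (map_zero κ.hom)).symm)
  | add t t' ht ht' =>
    refine (map_add _ _ _).trans ?_
    rw [ht, ht']
    exact (map_add κ.hom _ _).symm.trans (congrArg κ (map_add _ _ _).symm)
  | tmul c d =>
    refine e'.injective ?_
    refine Eq.trans ?_ (hκ _).symm
    rw [lidOfAugmentation_tmul, ridOfAugmentation_tmul]
    refine ((linearEquivOfAugmentation ε' e' he').map_smul (e c) d).trans ?_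
    refine Eq.trans ?_ ((linearEquivOfAugmentation ε e he).map_smul (e' d) c).symm
    exact mul_comm _ _

end ModuleCat

/-! ### Algebras generated by elements that commute up to automorphisms -/

section NormalElements

variable {k E G : Type*} [Field k] [Ring E] [Algebra k E] [Group G]

/-- An element `x` that commutes with every `a` up to a fixed automorphism `ρ γ` applied to `a`. -/
def IsTwistedCentral (ρ : G →* (E →ₐ[k] E)) (x : E) : Prop :=
  ∃ γ : G, ∀ a, a * x = x * ρ γ a

variable {ρ : G →* (E →ₐ[k] E)}

theorem map_mul_apply (g h : G) (a : E) : ρ (g * h) a = ρ g (ρ h a) := by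
  rw [map_mul]; rfl

theorem map_one_apply (a : E) : ρ 1 a = a := by
  rw [map_one]; rfl

/-- Applying `ρ g` to the commutation rule of `x` with `ρ g⁻¹ a` replaces `γ` by its conjugate under
`g`. Thus a set of twisted central generators can be made stable under the group. -/
theorem IsTwistedCentral.map {x : E} (hx : IsTwistedCentral ρ x) (g : G) :
    IsTwistedCentral ρ (ρ g x) := by
  obtain ⟨γ, hγ⟩ := hx
  refine ⟨g * γ * g⁻¹, fun a => ?_⟩
  have := congr(ρ g $(hγ (ρ g⁻¹ a)))
  rw [map_mul, map_mul, ← map_mul_apply, mul_inv_cancel, map_one_apply] at this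
  rw [this, map_mul_apply, map_mul_apply]

theorem mul_pow_eq_of_forall_mul_eq {x : E} {γ : G} (hx : ∀ a, a * x = x * ρ γ a) (n : ℕ) (a : E) :
    a * x ^ n = x ^ n * ρ (γ ^ n) a := by
  induction n generalizing a with
  | zero => simp
  | succ n ih => rw [pow_succ, ← mul_assoc, ih, mul_assoc, hx, ← map_mul_apply, ← pow_succ', mul_assoc]

/-- The power `x ^ n` commutes with everything up to `γ ^ n`, and `γ ^ |G| = 1`. -/
theorem IsTwistedCentral.pow_card_mem_center [Finite G] {x : E} (hx : IsTwistedCentral ρ x) :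
    x ^ Nat.card G ∈ Subalgebra.center k E := by
  obtain ⟨γ, hγ⟩ := hx
  rw [Subalgebra.mem_center_iff]
  intro a
  rw [mul_pow_eq_of_forall_mul_eq hγ, pow_card_eq_one', map_one_apply]

/-- If a letter occurs `j` times in a word in twisted central letters, it can be moved to the
front `j` times. -/
theorem exists_prod_eq_pow_mul_prod [DecidableEq E] {X : Set E}
    (hX : ∀ x ∈ X, IsTwistedCentral ρ x) (hρ : ∀ g, ∀ x ∈ X, ρ g x ∈ X) {x : E} (hx : x ∈ X)
    (l : List E) (hl : ∀ y ∈ l, y ∈ X) (j : ℕ) (hj : j ≤ l.count x) :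
    ∃ l' : List E, (∀ y ∈ l', y ∈ X) ∧ l.prod = x ^ j * l'.prod ∧ l'.length + j = l.length := by
  induction l generalizing j with
  | nil =>
    obtain rfl : j = 0 := by simpa using hj
    exact ⟨[], by simp, by simp, rfl⟩
  | cons a t ih =>
    rw [List.forall_mem_cons] at hl
    by_cases ha : a = x
    · subst ha
      obtain _ | j := j
      · exact ⟨a :: t, by simpa using hl, by simp, rfl⟩
      · rw [List.count_cons_self, Nat.add_le_add_iff_right] at hj
        obtain ⟨l', h₁, h₂, h₃⟩ := ih hl.2 j hj
        exact ⟨l', h₁, by rw [List.prod_cons, h₂, pow_succ', mul_assoc], by simp; lia⟩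
    · rw [List.count_cons_of_ne ha] at hj
      obtain ⟨l', h₁, h₂, h₃⟩ := ih hl.2 j hj
      obtain ⟨γ, hγ⟩ := hX x hx
      -- Moving `x ^ j` to the left past `a` turns `a` into `ρ (γ ^ j) a`, again a letter of `X`.
      refine ⟨ρ (γ ^ j) a :: l', ?_, ?_, by simp; lia⟩
      · exact List.forall_mem_cons.2 ⟨hρ _ _ hl.1, h₁⟩
      · rw [List.prod_cons, List.prod_cons, h₂, ← mul_assoc, mul_pow_eq_of_forall_mul_eq hγ,
          mul_assoc]

theorem List.exists_le_count_of_card_mul_le_length {α : Type*} [DecidableEq α] (s : Finset α)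
    (d : ℕ) (l : List α) (hl : ∀ y ∈ l, y ∈ s) (h : s.card * d < l.length) :
    ∃ x ∈ s, d ≤ l.count x := by
  by_contra! H
  have := Multiset.sum_count_eq_card (s := s) (m := (l : Multiset α)) (by simpa using hl)
  have h2 : ∑ a ∈ s, (l : Multiset α).count a ≤ ∑ a ∈ s, d :=
    Finset.sum_le_sum fun a ha => by simpa using (H a ha).le
  rw [this] at h2
  simp at h2
  lia

instance : Algebra (Subalgebra.center k E) E where
  algebraMap := (Subalgebra.center k E).val
  commutes' c a := (Subalgebra.mem_center_iff.1 c.2 a).symm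
  smul_def' _ _ := rfl

/-- An algebra generated over a central subalgebra by a finite stable set of integral twisted
central elements is a finite module. -/
theorem Module.finite_of_isTwistedCentral_of_isIntegral {B : Type*} [CommRing B] [Algebra k B]
    [Algebra B E] [IsScalarTower k B E] (X : Finset E) (hX : ∀ x ∈ X, IsTwistedCentral ρ x)
    (hρ : ∀ g, ∀ x ∈ X, ρ g x ∈ X) (hint : ∀ x ∈ X, IsIntegral B x)
    (hgen : Algebra.adjoin k (X : Set E) = ⊤) : Module.Finite B E := by
  classical
  choose! p hp using hint
  -- With `d` bounding the degrees of the integral equations, a word longer than `|X| d` contains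
  -- some letter `x` often enough to apply the equation of `x`. The finitely many words of length at
  -- most `|X| d` therefore span.
  let d := X.sup fun x => (p x).natDegree
  let W : Set E := {y | ∃ l : List E, (∀ x ∈ l, x ∈ X) ∧ l.length ≤ X.card * d ∧ l.prod = y}
  have hW : W.Finite := by
    refine ((List.finite_length_le X (X.card * d)).image
      fun l => (l.map Subtype.val).prod).subset ?_
    rintro _ ⟨l, h₁, h₂, rfl⟩
    lift l to List X using h₁
    exact ⟨l, by simpa using h₂, rfl⟩
  have key : ∀ (n : ℕ) (l : List E), l.length = n → (∀ x ∈ l, x ∈ X) →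
      l.prod ∈ Submodule.span B W := by
    intro n
    induction n using Nat.strong_induction_on with
    | _ n ih =>
    intro l hn hl
    by_cases hlen : l.length ≤ X.card * d
    · exact Submodule.subset_span ⟨l, hl, hlen, rfl⟩
    obtain ⟨x, hx, hcount⟩ :=
      List.exists_le_count_of_card_mul_le_length X d l hl (not_le.1 hlen)
    have hd : (p x).natDegree ≤ d := Finset.le_sup (f := fun x => (p x).natDegree) hx
    obtain ⟨l', h₁, h₂, h₃⟩ := exists_prod_eq_pow_mul_prod (X := X) hX hρ hx l hl _ (hd.trans hcount)
    -- Once gathered in front, the power of `x` is replaced by lower powers, which leaves a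
    -- combination of shorter words.
    have hpow : x ^ (p x).natDegree =
        -∑ i ∈ Finset.range (p x).natDegree, (p x).coeff i • x ^ i := by
      have h0 : Polynomial.aeval x (p x) = 0 := (hp x hx).2
      rw [Polynomial.aeval_eq_sum_range, Finset.sum_range_succ, (hp x hx).1.coeff_natDegree,
        one_smul] at h0
      exact eq_neg_of_add_eq_zero_right h0
    rw [h₂, hpow, neg_mul, Finset.sum_mul]
    refine neg_mem (sum_mem fun i hi => ?_)
    rw [smul_mul_assoc]
    refine Submodule.smul_mem _ _ ?_
    rw [Finset.mem_range] at hi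
    have := ih (i + l'.length) (by lia) (List.replicate i x ++ l') (by simp) (by
      intro y hy
      rw [List.mem_append, List.mem_replicate] at hy
      obtain ⟨-, rfl⟩ | hy := hy
      · exact hx
      · exact h₁ _ hy)
    simpa using this
  refine ⟨⟨hW.toFinset, ?_⟩⟩
  rw [hW.coe_toFinset, eq_top_iff]
  intro a _
  have ha : a ∈ Algebra.adjoin k (X : Set E) := by rw [hgen]; trivial
  rw [← Subalgebra.mem_toSubmodule, Algebra.adjoin_eq_span] at ha
  refine Submodule.span_induction (fun y hy => ?_) (zero_mem _) (fun _ _ _ _ => add_mem)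
    (fun r y _ hy => ?_) ha
  · obtain ⟨l, hl, rfl⟩ := Submonoid.exists_list_of_mem_closure hy
    exact key _ l rfl hl
  · rw [← algebraMap_smul B r y]
    exact Submodule.smul_mem _ _ hy

/-- A finitely generated algebra which is spanned by elements that are central up to the action of
a finite group is finite over a finitely generated central algebra of invariants. -/
theorem exists_subalgebra_finite_of_isTwistedCentral [Finite G] (hE : Algebra.FiniteType k E)
    (hspan : Submodule.span k {x : E | IsTwistedCentral ρ x} = ⊤) :
    ∃ B : Subalgebra k (Subalgebra.center k E), B.FG ∧ (∀ g, ∀ b ∈ B, ρ g b = b) ∧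
      Module.Finite B E := by
  classical
  cases nonempty_fintype G
  -- a finite stable set of generators
  obtain ⟨X, hX, hρ, hgen⟩ : ∃ X : Finset E, (∀ x ∈ X, IsTwistedCentral ρ x) ∧
      (∀ g, ∀ x ∈ X, ρ g x ∈ X) ∧ Algebra.adjoin k (X : Set E) = ⊤ := by
    obtain ⟨S, hS⟩ := hE.out
    -- Each generator is a combination of finitely many twisted central elements; the translates of
    -- these under the group form the stable set.
    obtain ⟨T, hT, hST⟩ : ∃ T : Finset E, (T : Set E) ⊆ {x | IsTwistedCentral ρ x} ∧
        (S : Set E) ⊆ Submodule.span k (T : Set E) := by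
      have h (s : E) : ∃ T : Finset E, (T : Set E) ⊆ {x | IsTwistedCentral ρ x} ∧
          s ∈ Submodule.span k (T : Set E) :=
        Submodule.mem_span_finite_of_mem_span (hspan ▸ Submodule.mem_top)
      choose T hT hs using h
      refine ⟨S.biUnion T, by simpa using fun s _ => hT s, fun s hs' => ?_⟩
      exact Submodule.span_mono (by exact_mod_cast Finset.subset_biUnion_of_mem T hs') (hs s)
    refine ⟨Finset.univ.biUnion fun g => T.image (ρ g), ?_, ?_, ?_⟩
    · intro x hx
      simp only [Finset.mem_biUnion, Finset.mem_image] at hx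
      obtain ⟨g, -, y, hy, rfl⟩ := hx
      exact (hT hy).map g
    · intro g x hx
      simp only [Finset.mem_biUnion, Finset.mem_image] at hx ⊢
      obtain ⟨h, -, y, hy, rfl⟩ := hx
      exact ⟨g * h, Finset.mem_univ _, y, hy, map_mul_apply _ _ _⟩
    · rw [eq_top_iff, ← hS, Algebra.adjoin_le_iff]
      refine hST.trans ?_
      have : Submodule.span k (T : Set E) ≤ Subalgebra.toSubmodule
          (Algebra.adjoin k ((Finset.univ.biUnion fun g => T.image (ρ g) : Finset E) : Set E)) := by
        rw [Submodule.span_le]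
        intro y hy
        refine Algebra.subset_adjoin ?_
        simp only [Finset.coe_biUnion, Set.mem_iUnion]
        exact ⟨1, Finset.mem_coe.2 (Finset.mem_univ _), Finset.mem_coe.2 (Finset.mem_image.2 ⟨y, hy, map_one_apply y⟩)⟩
      exact this
  let N := Nat.card G
  let Z := Subalgebra.center k E
  let z (x : X) : Z := ⟨x.1 ^ N, (hX x x.2).pow_card_mem_center⟩
  let gx (g : G) (x : X) : X := ⟨ρ g x, hρ g x x.2⟩
  -- The monic polynomial whose roots are the conjugates of the central element `x ^ |G|`. The group
  -- permutes its factors, so its coefficients are invariant.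
  let P (x : X) : Polynomial Z := ∏ g : G, (Polynomial.X - Polynomial.C (z (gx g x)))
  -- the action of the group on the centre
  let σ (g : G) : Z →ₐ[k] Z := ((ρ g).comp Z.val).codRestrict Z (fun c => by
    rw [Subalgebra.mem_center_iff]
    intro a
    have := congr(ρ g $(Subalgebra.mem_center_iff.1 c.2 (ρ g⁻¹ a)))
    simpa [← map_mul_apply, map_one_apply] using this)
  have hσz (g : G) (x : X) : σ g (z x) = z (gx g x) := Subtype.ext (map_pow (ρ g) x.1 N)
  have hσP (g : G) (x : X) : (P x).map (σ g : Z →+* Z) = P x := by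
    simp only [P, Polynomial.map_prod, Polynomial.map_sub, Polynomial.map_X, Polynomial.map_C]
    refine Fintype.prod_equiv (Equiv.mulLeft g) _ _ fun h => ?_
    have : (σ g : Z →+* Z) (z (gx h x)) = z (gx (g * h) x) := by
      refine (hσz g _).trans (congrArg z (Subtype.ext ?_))
      exact (map_mul_apply g h x.1).symm
    rw [this]; rfl
  let B : Subalgebra k Z := Algebra.adjoin k (⋃ x : X, ((P x).coeffs : Set Z))
  refine ⟨B, Subalgebra.fg_def.2 ⟨_, Set.finite_iUnion fun x => Finset.finite_toSet _, rfl⟩, ?_, ?_⟩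
  · intro g
    have : B ≤ AlgHom.equalizer (σ g) (AlgHom.id k Z) := by
      rw [Algebra.adjoin_le_iff]
      intro b hb
      obtain ⟨x, hc⟩ := Set.mem_iUnion.1 hb
      obtain ⟨n, -, rfl⟩ := Polynomial.mem_coeffs_iff.1 hc
      have := congr(Polynomial.coeff $(hσP g x) n)
      rw [Polynomial.coeff_map] at this
      exact this
    exact fun b hb => congrArg Subtype.val (this hb)
  · refine Module.finite_of_isTwistedCentral_of_isIntegral X hX hρ (fun x hx => ?_) hgen
    have hcoeff : (↑(P ⟨x, hx⟩).coeffs : Set Z) ⊆ B.toSubring :=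
      (Set.subset_iUnion (fun x : X => ((P x).coeffs : Set Z)) ⟨x, hx⟩).trans Algebra.subset_adjoin
    have hmonic : (P ⟨x, hx⟩).Monic := Polynomial.monic_prod_X_sub_C _ _
    have hz : IsIntegral B (z ⟨x, hx⟩) := by
      refine ⟨(P ⟨x, hx⟩).toSubring B.toSubring hcoeff,
        (Polynomial.monic_toSubring _ _ _).2 hmonic, ?_⟩
      have h : ((P ⟨x, hx⟩).toSubring B.toSubring hcoeff).map (algebraMap B Z) = P ⟨x, hx⟩ :=
        Polynomial.ext fun n => by rw [Polynomial.coeff_map]; exact Polynomial.coeff_toSubring _ _ _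
      rw [Polynomial.eval₂_eq_eval_map, h, Polynomial.eval_prod]
      refine Finset.prod_eq_zero (Finset.mem_univ 1) ?_
      have : gx 1 ⟨x, hx⟩ = ⟨x, hx⟩ := Subtype.ext (map_one_apply x)
      simp [this]
    -- The factor at `g = 1` makes `x ^ |G|` a root of `P x`, and integrality passes from a power of
    -- `x` to `x`.
    exact IsIntegral.of_pow Nat.card_pos (hz.algebraMap (B := E))

/-- Finiteness descends along an injective algebra map whose image contains a finitely generated
central subalgebra over which the target is finite. -/
theorem finite_of_injective_of_finite_subalgebra {H : Type*} [Ring H] [Algebra k H] (ι : H →ₐ[k] E)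
    (hι : Function.Injective ι) (B : Subalgebra k (Subalgebra.center k E)) (hB : B.FG)
    (hBι : ∀ b ∈ B, (b : E) ∈ ι.range) (hfin : Module.Finite B E) :
    Algebra.FiniteType k H ∧ ∀ (P Q : Type*) [AddCommGroup P] [AddCommGroup Q] [Module H P]
      [Module E Q] (j : P →+ Q), Module.Finite E Q → Function.Injective j →
      (∀ (h : H) (p : P), j (h • p) = ι h • j p) → Module.Finite H P := by
  have hex (b : B) : ∃ h : H, ι h = algebraMap B E b := hBι b b.2
  choose s hs using hex
  -- As `ι` is injective, the inclusion of `B` in `E` lifts to `H`, with central image; so `ι`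
  -- becomes `B`-linear.
  let σ : B →ₐ[k] H :=
    { toFun := s
      map_one' := hι (by rw [hs, map_one, map_one])
      map_mul' := fun a b => hι (by rw [hs, map_mul, map_mul, hs, hs])
      map_zero' := hι (by rw [hs, map_zero, map_zero])
      map_add' := fun a b => hι (by rw [hs, map_add, map_add, hs, hs])
      commutes' := fun r => hι (by rw [hs, AlgHom.commutes]; rfl) }
  let _ : Algebra B H := σ.toRingHom.toAlgebra' fun b h => hι (by
    change ι (s b * h) = ι (h * s b)
    rw [map_mul, map_mul, hs]
    exact Algebra.commutes b (ι h))
  have : IsScalarTower k B H := .of_algebraMap_eq fun r => (σ.commutes r).symm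
  have : Algebra.FiniteType k B := B.fg_iff_finiteType.1 hB
  have : IsNoetherianRing B := Algebra.FiniteType.isNoetherianRing k B
  have hsmul (b : B) (h : H) : ι (b • h) = b • ι h := by
    rw [Algebra.smul_def, Algebra.smul_def, map_mul]
    exact congr($(hs b) * ι h)
  -- `H` is a submodule of the finite module `E` over the Noetherian ring `B`. The same argument
  -- below applies to `P` inside `Q`.
  have : Module.Finite B H := Module.Finite.of_injective
    ({ toFun := ι, map_add' := map_add ι, map_smul' := hsmul } : H →ₗ[B] E) hι
  refine ⟨Algebra.FiniteType.trans ‹Algebra.FiniteType k B› inferInstance, ?_⟩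
  intro P Q _ _ _ _ j hQ hj hjs
  let _ : Module B P := Module.compHom P (algebraMap B H)
  have : IsScalarTower B E Q := .of_algebraMap_smul fun _ _ => rfl
  have : IsScalarTower B H P := .of_algebraMap_smul fun _ _ => rfl
  have : Module.Finite B Q := Module.Finite.trans E Q
  have : Module.Finite B P := Module.Finite.of_injective
    ({ toFun := j, map_add' := map_add j, map_smul' := fun b p => by
        change j (s b • p) = algebraMap B E b • j p
        rw [hjs, hs] } : P →ₗ[B] Q) hj
  exact Module.Finite.of_restrictScalars_finite B H P

end NormalElements

/-! ### The coaction of the bosonization -/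

namespace IsYetterDrinfeldHopfAlgebra

open SkewMonoidAlgebra

variable {k Γ R : Type u} [Field k] [Group Γ] [DecidableEq Γ] [Ring R] [Algebra k R]
  [MulSemiringAction Γ R] [SMulCommClass Γ k R] (𝒢 : Γ → Submodule k R)
  [DirectSum.Decomposition 𝒢]

/-- The coaction `x ↦ g ⊗ x`, for `x` of degree `g`. -/
def coaction : R →ₗ[k] SkewMonoidAlgebra R Γ ⊗[k] R :=
  DirectSum.toModule k Γ _ (fun g => TensorProduct.mk k _ R (of R Γ g) ∘ₗ (𝒢 g).subtype) ∘ₗ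
    (DirectSum.decomposeLinearEquiv 𝒢).toLinearMap

theorem coaction_apply {g : Γ} {x : R} (hx : x ∈ 𝒢 g) : coaction 𝒢 x = of R Γ g ⊗ₜ x := by
  lift x to 𝒢 g using hx
  simp [coaction]

/-- The map `R ⊗ R → (R # k Γ) ⊗ R` given by `x ⊗ y ↦ (x # g) ⊗ y`, for `y` of degree `g`. -/
def smashCoaction : R ⊗[k] R →ₗ[k] SkewMonoidAlgebra R Γ ⊗[k] R :=
  LinearMap.mul' k _ ∘ₗ TensorProduct.map
    ((Algebra.TensorProduct.includeLeft (R := k) (S := k) (B := R)).comp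
      (inclusion k Γ R)).toLinearMap (coaction 𝒢)

theorem smashCoaction_tmul (x : R) {g : Γ} {y : R} (hy : y ∈ 𝒢 g) :
    smashCoaction 𝒢 (x ⊗ₜ y) = single g x ⊗ₜ y := by
  simp [smashCoaction, coaction_apply 𝒢 hy, single_eq_inclusion_mul_of (k := k) g x]

/-- Pure tensors of homogeneous elements span the tensor square. -/
theorem tensorSquare_induction {p : R ⊗[k] R → Prop} (h₀ : p 0)
    (hadd : ∀ s t, p s → p t → p (s + t))
    (htmul : ∀ (x : R) (g : Γ) (y : R), y ∈ 𝒢 g → p (x ⊗ₜ y)) (t : R ⊗[k] R) : p t := by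
  induction t with
  | zero => exact h₀
  | add s t hs ht => exact hadd s t hs ht
  | tmul x y =>
    induction y using DirectSum.Decomposition.inductionOn 𝒢 with
    | zero => rw [TensorProduct.tmul_zero]; exact h₀
    | homogeneous y => exact htmul x _ y y.2
    | add y z hy hz => rw [TensorProduct.tmul_add]; exact hadd _ _ hy hz

variable {𝒢}

variable [Coalgebra k R]

/-- For `y` of degree `g`, the braiding moves `x'` past `y` as `g • x'`. The same twist occurs when
`x # g` is multiplied by `x' # g'`, so recording degrees in the first factor turns the braided
product into an ordinary one. -/
theorem smashCoaction_braidedMul (hR : IsYetterDrinfeldHopfAlgebra 𝒢) (s t : R ⊗[k] R) :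
    smashCoaction 𝒢 (braidedMul 𝒢 (s ⊗ₜ t)) = smashCoaction 𝒢 s * smashCoaction 𝒢 t := by
  induction s using tensorSquare_induction 𝒢 with
  | h₀ => simp
  | hadd s s' hs hs' => rw [TensorProduct.add_tmul, map_add, map_add, hs, hs', map_add, add_mul]
  | htmul x g y hy =>
    induction t using tensorSquare_induction 𝒢 with
    | h₀ => simp
    | hadd t t' ht ht' => rw [TensorProduct.tmul_add, map_add, map_add, ht, ht', map_add, mul_add]
    | htmul x' g' y' hy' =>
      rw [braidedMul_tmul 𝒢 x x' y' hy, smashCoaction_tmul 𝒢 _ (hR.mul_mem _ _ _ _ hy hy'),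
        smashCoaction_tmul 𝒢 _ hy, smashCoaction_tmul 𝒢 _ hy', Algebra.TensorProduct.tmul_mul_tmul,
        single_mul_single]

/-- The algebra map `R → (R # k Γ) ⊗ R` given by the comultiplication of the bosonization. -/
def smashComul (hR : IsYetterDrinfeldHopfAlgebra 𝒢) :
    R →ₐ[k] SkewMonoidAlgebra R Γ ⊗[k] R :=
  AlgHom.ofLinearMap (smashCoaction 𝒢 ∘ₗ Coalgebra.comul)
    (by
      rw [LinearMap.comp_apply, hR.comul_one, smashCoaction_tmul 𝒢 _ hR.one_mem]
      rfl)
    (fun x y => by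
      rw [LinearMap.comp_apply, hR.comul_mul, hR.smashCoaction_braidedMul]
      rfl)

theorem lid_map_smashCoaction (hR : IsYetterDrinfeldHopfAlgebra 𝒢) (t : R ⊗[k] R) :
    Algebra.TensorProduct.lid k R (Algebra.TensorProduct.map hR.bosonizationAugmentation
      (AlgHom.id k R) (smashCoaction 𝒢 t)) =
    TensorProduct.lid k R (LinearMap.rTensor R (Coalgebra.counit (R := k)) t) := by
  induction t using tensorSquare_induction 𝒢 with
  | h₀ => simp
  | hadd s t hs ht => simp only [map_add, hs, ht]
  | htmul x g y hy =>
    simp [smashCoaction_tmul 𝒢 _ hy, bosonizationAugmentation_single]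

theorem lid_map_smashComul (hR : IsYetterDrinfeldHopfAlgebra 𝒢) (x : R) :
    Algebra.TensorProduct.lid k R (Algebra.TensorProduct.map hR.bosonizationAugmentation
      (AlgHom.id k R) (hR.smashComul x)) = x := by
  refine (hR.lid_map_smashCoaction _).trans ?_
  rw [Coalgebra.rTensor_counit_comul]
  simp

/-- The counit kills all degrees other than `1`, so no nontrivial group element survives in the
first factor. -/
theorem rid_map_smashCoaction (hR : IsYetterDrinfeldHopfAlgebra 𝒢) (t : R ⊗[k] R) :
    Algebra.TensorProduct.rid k k (SkewMonoidAlgebra R Γ) (Algebra.TensorProduct.map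
      (AlgHom.id k (SkewMonoidAlgebra R Γ)) hR.augmentation (smashCoaction 𝒢 t)) =
    inclusion k Γ R (TensorProduct.rid k R
      (LinearMap.lTensor R (Coalgebra.counit (R := k)) t)) := by
  induction t using tensorSquare_induction 𝒢 with
  | h₀ => simp
  | hadd s t hs ht => simp only [map_add, hs, ht]
  | htmul x g y hy =>
    have h : hR.augmentation y = Coalgebra.counit (R := k) y := rfl
    by_cases hg : g = 1
    · subst hg
      simp [smashCoaction_tmul 𝒢 _ hy, h, inclusion_apply]
    · simp [smashCoaction_tmul 𝒢 _ hy, h, hR.counit_eq_zero g y hy hg]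

theorem rid_map_smashComul (hR : IsYetterDrinfeldHopfAlgebra 𝒢) (x : R) :
    Algebra.TensorProduct.rid k k (SkewMonoidAlgebra R Γ) (Algebra.TensorProduct.map
      (AlgHom.id k (SkewMonoidAlgebra R Γ)) hR.augmentation (hR.smashComul x)) =
    inclusion k Γ R x := by
  refine (hR.rid_map_smashCoaction _).trans ?_
  rw [Coalgebra.lTensor_counit_comul]
  simp

theorem bosonizationAugmentation_comp_inclusion (hR : IsYetterDrinfeldHopfAlgebra 𝒢) :
    hR.bosonizationAugmentation.comp (inclusion k Γ R) = hR.augmentation :=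
  AlgHom.ext fun x => hR.bosonizationAugmentation_single 1 x

theorem augmentation_comp_toAlgHom (hR : IsYetterDrinfeldHopfAlgebra 𝒢) (g : Γ) :
    hR.augmentation.comp (MulSemiringAction.toAlgHom k R g) = hR.augmentation :=
  AlgHom.ext fun x => hR.counit_smul g x

end IsYetterDrinfeldHopfAlgebra

/-! ### Composition of `Ext` classes with morphisms -/

namespace CategoryTheory.Abelian.Ext

universe w' w'' v' v'' u' u''

variable {C : Type u} [Category.{v} C] [Abelian C] [HasExt.{w} C]
  {D : Type u'} [Category.{v'} D] [Abelian D] [HasExt.{w'} D]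
  {E : Type u''} [Category.{v''} E] [Abelian E] [HasExt.{w''} E]

/-- Precomposition of an `Ext` class with a morphism. -/
def preMap {X X' Y : C} {n : ℕ} (f : X ⟶ X') (α : Ext X' Y n) : Ext X Y n :=
  (mk₀ f).comp α (zero_add n)

/-- Postcomposition of an `Ext` class with a morphism. -/
def postMap {X Y Y' : C} {n : ℕ} (α : Ext X Y n) (g : Y ⟶ Y') : Ext X Y' n :=
  α.comp (mk₀ g) (add_zero n)

section

variable {X X' X'' Y Y' Y'' Z : C} {m n p : ℕ}

theorem preMap_preMap (f : X ⟶ X') (f' : X' ⟶ X'') (α : Ext X'' Y n) :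
    preMap f (preMap f' α) = preMap (f ≫ f') α := by
  rw [preMap, preMap, preMap, ← mk₀_comp_mk₀, comp_assoc_of_second_deg_zero]

theorem postMap_postMap (α : Ext X Y n) (g : Y ⟶ Y') (g' : Y' ⟶ Y'') :
    postMap (postMap α g) g' = postMap α (g ≫ g') := by
  rw [postMap, postMap, postMap, ← mk₀_comp_mk₀, comp_assoc_of_second_deg_zero]

theorem postMap_preMap (f : X ⟶ X') (α : Ext X' Y n) (g : Y ⟶ Y') :
    postMap (preMap f α) g = preMap f (postMap α g) := by
  rw [postMap, postMap, preMap, preMap, comp_assoc_of_third_deg_zero]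

theorem preMap_comp (f : X ⟶ X') (α : Ext X' Y m) (β : Ext Y Z n) (h : m + n = p) :
    (preMap f α).comp β h = preMap f (α.comp β h) := by
  rw [preMap, preMap, comp_assoc]
  lia

theorem comp_postMap (α : Ext X Y m) (β : Ext Y Z n) (g : Z ⟶ Y') (h : m + n = p) :
    α.comp (postMap β g) h = postMap (α.comp β h) g := by
  rw [postMap, postMap, comp_assoc_of_third_deg_zero]

theorem comp_preMap (α : Ext X Y m) (f : Y ⟶ Y') (β : Ext Y' Z n) (h : m + n = p) :
    α.comp (preMap f β) h = (postMap α f).comp β h := by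
  rw [preMap, postMap, comp_assoc_of_second_deg_zero]

theorem preMap_id (α : Ext X Y n) : preMap (𝟙 X) α = α := mk₀_id_comp α

theorem postMap_id (α : Ext X Y n) : postMap α (𝟙 Y) = α := comp_mk₀_id α

theorem preMap_add (f : X ⟶ X') (α β : Ext X' Y n) :
    preMap f (α + β) = preMap f α + preMap f β := comp_add _ _ _ _

theorem add_postMap (α β : Ext X Y n) (g : Y ⟶ Y') :
    postMap (α + β) g = postMap α g + postMap β g := add_comp _ _ _ _

theorem preMap_zsmul (f : X ⟶ X') (α : Ext X' Y n) (r : ℤ) :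
    preMap f (r • α) = r • preMap f α := comp_zsmul _ _ _ _

theorem zsmul_postMap (α : Ext X Y n) (g : Y ⟶ Y') (r : ℤ) :
    postMap (r • α) g = r • postMap α g := zsmul_comp _ _ _ _

theorem sum_preMap {ι : Type*} (s : Finset ι) (f : ι → (X ⟶ X')) (α : Ext X' Y n) :
    preMap (∑ i ∈ s, f i) α = ∑ i ∈ s, preMap (f i) α := by
  let φ : (X ⟶ X') →+ Ext X Y n := AddMonoidHom.mk' (fun f => preMap f α) fun f g => by
    rw [preMap, mk₀_add, add_comp]; rfl
  exact map_sum φ f s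

theorem postMap_sum {ι : Type*} (s : Finset ι) (α : Ext X Y n) (g : ι → (Y ⟶ Y')) :
    postMap α (∑ i ∈ s, g i) = ∑ i ∈ s, postMap α (g i) := by
  let φ : (Y ⟶ Y') →+ Ext X Y' n := AddMonoidHom.mk' (fun g => postMap α g) fun f g => by
    rw [postMap, mk₀_add, comp_add]; rfl
  exact map_sum φ g s

theorem preMap_smul {k : Type*} [Ring k] [Linear k C] (f : X ⟶ X') (r : k) (α : Ext X' Y n) :
    preMap f (r • α) = r • preMap f α := comp_smul _ _ _ _

theorem smul_postMap {k : Type*} [Ring k] [Linear k C] (r : k) (α : Ext X Y n) (g : Y ⟶ Y') :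
    postMap (r • α) g = r • postMap α g := smul_comp _ _ _ _

theorem preMap_injective (e : X ≅ X') : Function.Injective (preMap (Y := Y) (n := n) e.hom) :=
  Function.LeftInverse.injective (g := preMap e.inv) fun α => by
    rw [preMap_preMap, e.inv_hom_id, preMap_id]

theorem postMap_injective (e : Y ≅ Y') :
    Function.Injective (fun α : Ext X Y n => postMap α e.hom) :=
  Function.LeftInverse.injective (g := fun α => postMap α e.inv) fun α => by
    simp only [postMap_postMap, e.hom_inv_id, postMap_id]

variable (F : C ⥤ D) [F.Additive] [PreservesFiniteLimits F] [PreservesFiniteColimits F]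

theorem mapExactFunctor_preMap (f : X ⟶ X') (α : Ext X' Y n) :
    (preMap f α).mapExactFunctor F = preMap (F.map f) (α.mapExactFunctor F) := by
  rw [preMap, mapExactFunctor_comp, mapExactFunctor_mk₀]; rfl

theorem mapExactFunctor_postMap (α : Ext X Y n) (g : Y ⟶ Y') :
    (postMap α g).mapExactFunctor F = postMap (α.mapExactFunctor F) (F.map g) := by
  rw [postMap, mapExactFunctor_comp, mapExactFunctor_mk₀]; rfl

variable {F} {F' : C ⥤ D} [F'.Additive] [PreservesFiniteLimits F'] [PreservesFiniteColimits F']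

theorem postMap_mapExactFunctor_app [EnoughProjectives C] (τ : F ⟶ F') (α : Ext X Y n) :
    postMap (α.mapExactFunctor F) (τ.app Y) = preMap (τ.app X) (α.mapExactFunctor F') :=
  mapExactFunctor_naturality τ α

end

/-! ### Self-extensions under exact functors, and the transfer -/

section Conj

variable (F : C ⥤ D) [F.Additive] [PreservesFiniteLimits F] [PreservesFiniteColimits F]
  {X X' : C} {Y Y' : D} (e : F.obj X ≅ Y) {m n p : ℕ}

/-- The action of an exact functor on self-extensions of an object with known image. -/
def mapConj (α : Ext X X n) : Ext Y Y n :=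
  preMap e.inv (postMap (α.mapExactFunctor F) e.hom)

theorem mapConj_add (α β : Ext X X n) : mapConj F e (α + β) = mapConj F e α + mapConj F e β := by
  rw [mapConj, mapExactFunctor_add, add_postMap, preMap_add]; rfl

theorem mapConj_smul {k : Type*} [Ring k] [Linear k C] [Linear k D] [F.Linear k] (r : k)
    (α : Ext X X n) : mapConj F e (r • α) = r • mapConj F e α := by
  rw [mapConj, F.mapExactFunctor_smul, smul_postMap, preMap_smul]; rfl

theorem mapConj_comp (α : Ext X X m) (β : Ext X X n) (h : m + n = p) :
    mapConj F e (α.comp β h) = (mapConj F e α).comp (mapConj F e β) h := by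
  rw [mapConj, mapConj, mapConj, preMap_comp, comp_preMap, postMap_postMap, e.hom_inv_id, postMap_id,
    comp_postMap, mapExactFunctor_comp]

theorem mapConj_mk₀_id : mapConj F e (mk₀ (𝟙 X)) = mk₀ (𝟙 Y) := by
  rw [mapConj, mapExactFunctor_mk₀, F.map_id, preMap, postMap, mk₀_comp_mk₀, mk₀_comp_mk₀,
    Category.id_comp, e.inv_hom_id]

theorem preMap_mapConj (α : Ext X X n) :
    preMap e.hom (mapConj F e α) = postMap (α.mapExactFunctor F) e.hom := by
  rw [mapConj, preMap_preMap, e.hom_inv_id, preMap_id]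

theorem mapConj_injective (hF : Function.Injective (mapExactFunctor F (X := X) (Y := X) (n := n))) :
    Function.Injective (mapConj F e (n := n)) :=
  (preMap_injective e.symm).comp ((postMap_injective e).comp hF)

/-- A natural transformation suffices: its value at `X` is tied to the chosen identifications by
`hτ`, and naturality on `Ext` does the rest. Applied to twists, this yields a group action. -/
theorem mapConj_mapConj [EnoughProjectives C] [EnoughProjectives D] {Z : E} (G : D ⥤ E)
    [G.Additive] [PreservesFiniteLimits G] [PreservesFiniteColimits G] (e' : G.obj Y ≅ Z)
    (H : C ⥤ E) [H.Additive] [PreservesFiniteLimits H] [PreservesFiniteColimits H]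
    (e'' : H.obj X ≅ Z) (τ : H ⟶ F ⋙ G) (hτ : e''.hom = τ.app X ≫ G.map e.hom ≫ e'.hom)
    (α : Ext X X n) : mapConj G e' (mapConj F e α) = mapConj H e'' α := by
  refine preMap_injective e'' ?_
  rw [preMap_mapConj, hτ, ← preMap_preMap, ← preMap_preMap, preMap_mapConj,
    ← postMap_preMap, ← mapExactFunctor_preMap, preMap_mapConj, mapExactFunctor_postMap,
    ← postMap_preMap, ← postMap_preMap, ← postMap_postMap, ← postMap_postMap,
    postMap_mapExactFunctor_app, mapExactFunctor_comp_functor]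

theorem mapConj_eq_self [EnoughProjectives C] (G : C ⥤ C) [G.Additive] [PreservesFiniteLimits G]
    [PreservesFiniteColimits G] (e : G.obj X ≅ X) (τ : G ⟶ 𝟭 C) (hτ : τ.app X = e.hom)
    (α : Ext X X n) : mapConj G e α = α := by
  refine preMap_injective e ?_
  rw [preMap_mapConj, ← hτ, postMap_mapExactFunctor_app, mapExactFunctor_id]

/-- The transfer of a self-extension. -/
theorem mapConj_transfer {ι : Type*} [Fintype ι] [EnoughProjectives C] [EnoughProjectives D]
    (G : D ⥤ C) [G.Additive] [PreservesFiniteLimits G] [PreservesFiniteColimits G]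
    (T : ι → D ⥤ D) [∀ u, (T u).Additive] [∀ u, PreservesFiniteLimits (T u)]
    [∀ u, PreservesFiniteColimits (T u)] (θ : ∀ u, (T u).obj Y ≅ Y) (i : ∀ u, T u ⟶ G ⋙ F)
    (a : X ⟶ G.obj Y) (b : G.obj Y ⟶ X)
    (ha : e.inv ≫ F.map a = ∑ u, (θ u).inv ≫ (i u).app Y)
    (hb : ∀ u, (i u).app Y ≫ F.map b ≫ e.hom = (θ u).hom) (α : Ext Y Y n) :
    mapConj F e (preMap a (postMap (α.mapExactFunctor G) b)) = ∑ u, mapConj (T u) (θ u) α := by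
  rw [mapConj, mapExactFunctor_preMap, mapExactFunctor_postMap, postMap_preMap, postMap_postMap,
    preMap_preMap, ha, sum_preMap]
  -- On the part indexed by `u`, naturality of `i u` replaces `F (G α)` by `T u α`.
  refine Finset.sum_congr rfl fun u _ => ?_
  rw [mapConj, ← preMap_preMap, ← hb u]
  refine congrArg (preMap (θ u).inv) ?_
  have key := postMap_mapExactFunctor_app (i u) α
  rw [mapExactFunctor_comp_functor] at key
  exact (postMap_preMap _ _ _).symm.trans
    ((congrArg (fun β => postMap β (F.map b ≫ e.hom)) key.symm).trans (postMap_postMap _ _ _))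

end Conj

/-! ### Braided commutativity from a bifunctor with unit constraints -/

section BraidedCommutativity

variable (B : C ⥤ D ⥤ D) [B.IsExactBifunctor] (F : C ⥤ D) [F.Additive] [PreservesFiniteLimits F]
  [PreservesFiniteColimits F] {Y : D} (μ : B.flip.obj Y ≅ F) {m n p : ℕ}

/-- The isomorphism `B(W, Y) ≅ F W`. -/
def unitIso (W : C) : (B.obj W).obj Y ≅ F.obj W := μ.app W

theorem map_app_comp_unitIso_hom {W W' : C} (f : W ⟶ W') :
    (B.map f).app Y ≫ (unitIso B F μ W').hom = (unitIso B F μ W).hom ≫ F.map f :=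
  μ.hom.naturality f

theorem postMap_mapLeft_unitIso_hom [EnoughProjectives C] {W W' : C} (α : Ext W W' n) :
    postMap (mapLeft B α Y) (unitIso B F μ W').hom =
      preMap (unitIso B F μ W).hom (α.mapExactFunctor F) :=
  postMap_mapExactFunctor_app μ.hom α

/-- The `Ext` class on `F W` obtained by tensoring a self-extension of the unit object with `W`. -/
def tensorClass (W : C) (β : Ext Y Y n) : Ext (F.obj W) (F.obj W) n :=
  preMap (unitIso B F μ W).inv (postMap (mapRight B W β) (unitIso B F μ W).hom)

theorem preMap_tensorClass (W : C) (β : Ext Y Y n) :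
    preMap (unitIso B F μ W).hom (tensorClass B F μ W β) =
      postMap (mapRight B W β) (unitIso B F μ W).hom := by
  rw [tensorClass, preMap_preMap, Iso.hom_inv_id, preMap_id]

/-- Under `B(W, Y) ≅ F W` the class `F α` becomes `α` acting in the first variable and the tensor
class becomes `β` acting in the second, so the sign rule for bifunctors applies. -/
theorem mapExactFunctor_comp_tensorClass [EnoughProjectives C] [EnoughProjectives D] {W W' : C}
    (α : Ext W W' m) (β : Ext Y Y n) (h : m + n = p) :
    (α.mapExactFunctor F).comp (tensorClass B F μ W' β) h =
      (-1 : ℤ) ^ (m * n) • (tensorClass B F μ W β).comp (α.mapExactFunctor F) (by lia) := by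
  refine preMap_injective (unitIso B F μ W) ?_
  rw [preMap_zsmul, ← preMap_comp, ← preMap_comp, preMap_tensorClass, ← comp_preMap,
    ← postMap_mapLeft_unitIso_hom, comp_postMap, ← comp_preMap,
    preMap_tensorClass, comp_postMap, mapLeft_comp_mapRight, zsmul_postMap]

theorem postMap_tensorClass_map [EnoughProjectives D] {W W' : C}
    (f : W ⟶ W') (β : Ext Y Y n) :
    postMap (tensorClass B F μ W β) (F.map f) = preMap (F.map f) (tensorClass B F μ W' β) := by
  refine preMap_injective (unitIso B F μ W) ?_
  rw [preMap_preMap, ← map_app_comp_unitIso_hom, ← preMap_preMap, preMap_tensorClass,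
    ← postMap_preMap, preMap_tensorClass, postMap_postMap, ← map_app_comp_unitIso_hom,
    ← postMap_postMap, ← postMap_preMap]
  exact congrArg (fun γ => postMap γ (unitIso B F μ W').hom) (mapRight_naturality B f β)

/-- The transformation `ev` carries the action of `β` on `B(X, Y)` to `β` itself; by `h` it agrees
at `Y` with the identification used to define the tensor class. -/
theorem postMap_tensorClass_of_unit [EnoughProjectives D] {X : C} (ev : B.obj X ⟶ 𝟭 D)
    (e : F.obj X ≅ Y) (h : ev.app Y = (unitIso B F μ X).hom ≫ e.hom) (β : Ext Y Y n) :
    postMap (tensorClass B F μ X β) e.hom = preMap e.hom β := by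
  refine preMap_injective (unitIso B F μ X) ?_
  rw [← postMap_preMap, preMap_tensorClass, postMap_postMap, preMap_preMap, ← h]
  refine (postMap_mapExactFunctor_app ev β).trans ?_
  rw [mapExactFunctor_id]

/-- The component of a self-extension `β` of the unit object for a morphism `q` and the
projection `q'`. -/
def twistedComponent {W : C} (q : Y ⟶ F.obj W) (q' : F.obj W ⟶ Y) (β : Ext Y Y n) : Ext Y Y n :=
  preMap q (postMap (tensorClass B F μ W β) q')

/-- `a` enters through `q` as `F α`, passes the tensor class at the cost of a sign, and leaves
through `q'` as `a'`. -/
theorem comp_twistedComponent [EnoughProjectives C] [EnoughProjectives D] {W : C}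
    (q : Y ⟶ F.obj W) (q' : F.obj W ⟶ Y) (α : Ext W W m) (a a' : Ext Y Y m)
    (hq : postMap a q = preMap q (α.mapExactFunctor F))
    (hq' : postMap (α.mapExactFunctor F) q' = preMap q' a') (β : Ext Y Y n) (h : m + n = p) :
    a.comp (twistedComponent B F μ q q' β) h =
      (-1 : ℤ) ^ (m * n) • (twistedComponent B F μ q q' β).comp a' (by lia) := by
  rw [twistedComponent, comp_preMap, hq, comp_postMap, preMap_comp,
    mapExactFunctor_comp_tensorClass, preMap_zsmul, zsmul_postMap, postMap_preMap, ← comp_postMap, hq',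
    comp_preMap, preMap_comp]

/-- The projections add up to a map induced by `b`. Naturality of tensor classes then moves the
computation from `W` to the unit object `X`, where the tensor class is `β`. -/
theorem sum_twistedComponent [EnoughProjectives D] {ι : Type*} [Fintype ι] {W X : C}
    (ev : B.obj X ⟶ 𝟭 D) (e : F.obj X ≅ Y) (h : ev.app Y = (unitIso B F μ X).hom ≫ e.hom)
    (q : Y ⟶ F.obj W) (q' : ι → (F.obj W ⟶ Y)) (b : W ⟶ X)
    (hq : q ≫ F.map b ≫ e.hom = 𝟙 Y) (hq' : ∑ u, q' u = F.map b ≫ e.hom) (β : Ext Y Y n) :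
    ∑ u, twistedComponent B F μ q (q' u) β = β := by
  simp only [twistedComponent, ← postMap_preMap, ← postMap_sum]
  rw [hq', ← postMap_postMap, postMap_preMap, postMap_tensorClass_map, postMap_preMap, postMap_preMap,
    postMap_tensorClass_of_unit B F μ ev e h, preMap_preMap, preMap_preMap, Category.assoc, hq,
    preMap_id]

end BraidedCommutativity

end CategoryTheory.Abelian.Ext

theorem DirectSum.toAlgebra_of {k ι B : Type*} {A : ι → Type*} [DecidableEq ι] [AddMonoid ι]
    [CommSemiring k] [∀ i, AddCommMonoid (A i)] [∀ i, Module k (A i)] [DirectSum.GSemiring A]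
    [DirectSum.GAlgebra k A] [Semiring B] [Algebra k B] (f : ∀ i, A i →ₗ[k] B)
    (hone : f _ GradedMonoid.GOne.one = 1)
    (hmul : ∀ {i j} (a : A i) (b : A j), f _ (GradedMonoid.GMul.mul a b) = f _ a * f _ b)
    (i : ι) (a : A i) : DirectSum.toAlgebra k A f hone hmul (DirectSum.of A i a) = f i a := by
  rw [DirectSum.toAlgebra_apply]
  exact DirectSum.toSemiring_of _ hone hmul i a

/-! ### Maps between Yoneda algebras -/

namespace YonedaExt

universe w' v' u'

variable {C : Type u} [Category.{v} C] [Abelian C] [HasExt.{w} C]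
  {D : Type u'} [Category.{v'} D] [Abelian D] [HasExt.{w'} D]

instance gRing (X : C) : DirectSum.GRing (fun n : ℕ => Ext X X n) where
  __ := gSemiring X
  intCast z := z • Ext.mk₀ (𝟙 X)
  intCast_ofNat n := natCast_zsmul _ n
  intCast_negSucc_ofNat n := negSucc_zsmul _ n

theorem of_mul_of {X : C} {m n p : ℕ} (α : Ext X X m) (β : Ext X X n) (h : m + n = p) :
    DirectSum.of (fun n => Ext X X n) m α * DirectSum.of (fun n => Ext X X n) n β =
      DirectSum.of (fun n => Ext X X n) p (α.comp β h) := by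
  subst h
  exact DirectSum.of_mul_of α β

theorem of_smul_of {X M : C} {m n p : ℕ} (α : Ext X X m) (β : Ext X M n) (h : m + n = p) :
    DirectSum.of (fun n => Ext X X n) m α • DirectSum.of (fun n => Ext X M n) n β =
      DirectSum.of (fun n => Ext X M n) p (α.comp β h) := by
  subst h
  exact DirectSum.Gmodule.of_smul_of _ _ α β

variable (k : Type*) [Field k] [Linear k C] [Linear k D]
  (F : C ⥤ D) [F.Additive] [F.Linear k] [PreservesFiniteLimits F] [PreservesFiniteColimits F]
  {X : C} {Y : D} (e : F.obj X ≅ Y)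

/-- The components of the map of Yoneda algebras given by an exact functor. -/
def mapLinearMap (n : ℕ) : Ext X X n →ₗ[k] ⨁ n : ℕ, Ext Y Y n :=
  DirectSum.lof k ℕ (fun n => Ext Y Y n) n ∘ₗ
    { toFun := Ext.mapConj F e
      map_add' := Ext.mapConj_add F e
      map_smul' := Ext.mapConj_smul F e }

theorem mapLinearMap_apply {n : ℕ} (α : Ext X X n) :
    mapLinearMap k F e n α = DirectSum.of (fun n => Ext Y Y n) n (Ext.mapConj F e α) := rfl

theorem mapLinearMap_mul {m n : ℕ} (α : Ext X X m) (β : Ext X X n) :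
    mapLinearMap k F e (m + n) (GradedMonoid.GMul.mul α β) =
      mapLinearMap k F e m α * mapLinearMap k F e n β := by
  rw [mapLinearMap_apply, mapLinearMap_apply, mapLinearMap_apply, of_mul_of _ _ rfl]
  exact congrArg (DirectSum.of (fun n => Ext Y Y n) _) (Ext.mapConj_comp F e α β rfl)

/-- The map of Yoneda algebras given by an exact functor. -/
def mapAlgHom : (⨁ n : ℕ, Ext X X n) →ₐ[k] ⨁ n : ℕ, Ext Y Y n :=
  DirectSum.toAlgebra k (fun n : ℕ => Ext X X n) (mapLinearMap k F e)
    (by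
      rw [mapLinearMap_apply]
      exact congrArg (DirectSum.of (fun n => Ext Y Y n) 0) (Ext.mapConj_mk₀_id F e))
    (mapLinearMap_mul k F e)

theorem mapAlgHom_of {n : ℕ} (α : Ext X X n) :
    mapAlgHom k F e (DirectSum.of (fun n => Ext X X n) n α) =
      DirectSum.of (fun n => Ext Y Y n) n (Ext.mapConj F e α) := by
  rw [mapAlgHom, DirectSum.toAlgebra_of (hmul := mapLinearMap_mul k F e), mapLinearMap_apply]

theorem mapAlgHom_apply (x : ⨁ n : ℕ, Ext X X n) (n : ℕ) :
    mapAlgHom k F e x n = Ext.mapConj F e (x n) := by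
  induction x using DirectSum.induction_on with
  | zero => exact (map_zero (AddMonoidHom.mk' (Ext.mapConj F e (n := n)) (Ext.mapConj_add F e))).symm
  | add x y hx hy =>
    rw [map_add, DirectSum.add_apply, DirectSum.add_apply, hx, hy, Ext.mapConj_add]
  | of m α =>
    rw [mapAlgHom_of]
    by_cases h : m = n
    · subst h; rw [DirectSum.of_eq_same, DirectSum.of_eq_same]
    · rw [DirectSum.of_eq_of_ne _ _ _ (Ne.symm h), DirectSum.of_eq_of_ne _ _ _ (Ne.symm h)]
      exact (map_zero (AddMonoidHom.mk' (Ext.mapConj F e (n := n)) (Ext.mapConj_add F e))).symm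

theorem mapAlgHom_injective
    (hF : ∀ n, Function.Injective (Ext.mapExactFunctor F (X := X) (Y := X) (n := n))) :
    Function.Injective (mapAlgHom k F e) := fun x y h =>
  DFinsupp.ext fun n => Ext.mapConj_injective F e (hF n) <| by
    rw [← mapAlgHom_apply k, ← mapAlgHom_apply k, h]

variable (M : C)

/-- The map of modules over Yoneda algebras given by an exact functor. -/
def mapModule : (⨁ n : ℕ, Ext X M n) →+ ⨁ n : ℕ, Ext Y (F.obj M) n :=
  DirectSum.map fun n => AddMonoidHom.mk'
    (fun α : Ext X M n => Ext.preMap e.inv (α.mapExactFunctor F)) fun α β => by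
      rw [Ext.mapExactFunctor_add, Ext.preMap_add]

theorem mapModule_smul (x : ⨁ n : ℕ, Ext X X n) (y : ⨁ n : ℕ, Ext X M n) :
    mapModule F e M (x • y) = mapAlgHom k F e x • mapModule F e M y := by
  induction x using DirectSum.induction_on with
  | zero => simp
  | add x x' hx hx' => rw [add_smul, map_add, hx, hx', map_add, add_smul]
  | of m α =>
    induction y using DirectSum.induction_on with
    | zero => simp
    | add y y' hy hy' => rw [smul_add, map_add, hy, hy', map_add, smul_add]
    | of n β =>
      rw [of_smul_of α β rfl, mapAlgHom_of, mapModule, DirectSum.map_of, DirectSum.map_of,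
        of_smul_of _ _ rfl]
      refine congrArg (DirectSum.of (fun n => Ext Y (F.obj M) n) _) ?_
      change Ext.preMap e.inv ((α.comp β rfl).mapExactFunctor F) =
        (Ext.mapConj F e α).comp (Ext.preMap e.inv (β.mapExactFunctor F)) rfl
      rw [Ext.mapConj, Ext.preMap_comp, Ext.comp_preMap, Ext.postMap_postMap, e.hom_inv_id,
        Ext.postMap_id, Ext.mapExactFunctor_comp]

theorem mapModule_injective
    (hF : ∀ n, Function.Injective (Ext.mapExactFunctor F (X := X) (Y := M) (n := n))) :
    Function.Injective (mapModule F e M) :=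
  (DirectSum.map_injective _).2 fun n => (Ext.preMap_injective e.symm).comp (hF n)

variable (X)

/-- The components of the action of a sign on a Yoneda algebra. -/
def signLinearMap (s : ℤˣ) (n : ℕ) : Ext X X n →ₗ[k] ⨁ n : ℕ, Ext X X n :=
  ((s : ℤ) ^ n) • DirectSum.lof k ℕ (fun n => Ext X X n) n

variable {X} in
theorem signLinearMap_apply (s : ℤˣ) {n : ℕ} (α : Ext X X n) :
    signLinearMap k X s n α = (s : ℤ) ^ n • DirectSum.of (fun n => Ext X X n) n α := rfl

variable {X} in
theorem signLinearMap_mul (s : ℤˣ) {m n : ℕ} (α : Ext X X m) (β : Ext X X n) :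
    signLinearMap k X s (m + n) (GradedMonoid.GMul.mul α β) =
      signLinearMap k X s m α * signLinearMap k X s n β := by
  rw [signLinearMap_apply, signLinearMap_apply, signLinearMap_apply, smul_mul_smul_comm,
    of_mul_of _ _ rfl, pow_add]
  rfl

/-- The action of a sign on a Yoneda algebra: the identity in even degrees and multiplication by
the sign in odd degrees. -/
def signAlgHom (s : ℤˣ) : (⨁ n : ℕ, Ext X X n) →ₐ[k] ⨁ n : ℕ, Ext X X n :=
  DirectSum.toAlgebra k (fun n : ℕ => Ext X X n) (signLinearMap k X s)
    (by
      rw [signLinearMap_apply, pow_zero, one_smul]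
      rfl)
    (signLinearMap_mul k s)

theorem signAlgHom_of (s : ℤˣ) {n : ℕ} (α : Ext X X n) :
    signAlgHom k X s (DirectSum.of (fun n => Ext X X n) n α) =
      (s : ℤ) ^ n • DirectSum.of (fun n => Ext X X n) n α := by
  refine Eq.trans ?_ (signLinearMap_apply k s α)
  exact DirectSum.toAlgebra_of (signLinearMap k X s) _ (signLinearMap_mul k s) n α

/-- The action of signs on a Yoneda algebra. -/
def signAction : ℤˣ →* ((⨁ n : ℕ, Ext X X n) →ₐ[k] ⨁ n : ℕ, Ext X X n) where
  toFun := signAlgHom k X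
  map_one' := DirectSum.algHom_ext k _ fun n α => by
    rw [signAlgHom_of, Units.val_one, one_pow, one_smul]
    rfl
  map_mul' s t := DirectSum.algHom_ext k _ fun n α => by
    rw [AlgHom.mul_apply, signAlgHom_of, signAlgHom_of, map_zsmul, signAlgHom_of, smul_smul,
      ← mul_pow, Units.val_mul, mul_comm]

variable {X}

theorem commute_signAlgHom (G : C ⥤ C) [G.Additive] [G.Linear k] [PreservesFiniteLimits G]
    [PreservesFiniteColimits G] (e : G.obj X ≅ X) (s : ℤˣ) :
    Commute (mapAlgHom k G e) (signAlgHom k X s) :=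
  DirectSum.algHom_ext k _ fun n α => by
    rw [AlgHom.mul_apply, AlgHom.mul_apply, signAlgHom_of, map_zsmul, mapAlgHom_of, signAlgHom_of]

end YonedaExt

/-! ### The cohomology of the bosonization -/

namespace SkewMonoidAlgebra

open ModuleCat

variable {k Γ R : Type u} [Field k] [Group Γ] [Ring R] [Algebra k R] [MulSemiringAction Γ R]
  [SMulCommClass Γ k R]

theorem smul_eq_inclusion_mul (r : R) (a : SkewMonoidAlgebra R Γ) :
    r • a = inclusion k Γ R r * a := by
  induction a using SkewMonoidAlgebra.induction_on with
  | zero => rw [smul_zero, mul_zero]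
  | single g s => rw [inclusion_apply, single_mul_single, one_smul, one_mul, smul_single]; rfl
  | add a b ha hb => rw [smul_add, mul_add, ha, hb]

theorem finite_restr [Finite Γ] (M : ModuleCat.{u} (SkewMonoidAlgebra R Γ))
    [hM : Module.Finite (SkewMonoidAlgebra R Γ) M] : Module.Finite R ((restr k Γ R).obj M) := by
  let _ : Module (SkewMonoidAlgebra R Γ) ((restr k Γ R).obj M) := M.isModule
  have : Module.Finite (SkewMonoidAlgebra R Γ) ((restr k Γ R).obj M) := hM
  have : Module.Finite R (SkewMonoidAlgebra R Γ) :=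
    Module.Finite.equiv (coeffLinearEquiv (S := R) (k := R) (G := Γ)).symm
  have : IsScalarTower R (SkewMonoidAlgebra R Γ) ((restr k Γ R).obj M) :=
    ⟨fun r a (m : M) => (congrArg (fun b : SkewMonoidAlgebra R Γ => b • m)
      (smul_eq_inclusion_mul (k := k) r a)).trans (mul_smul (inclusion k Γ R r) a m)⟩
  exact Module.Finite.trans (SkewMonoidAlgebra R Γ) _

variable (k Γ R) in
/-- Twisting by the unit. -/
def twistOne : twist k R (1 : Γ) ⟶ 𝟭 (ModuleCat.{u} R) where
  app M := ConcreteCategory.ofHom (C := ModuleCat R)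
    { toFun := fun m : M => m
      map_add' := fun _ _ => rfl
      map_smul' := fun r (m : M) => by
        change ((1 : Γ)⁻¹ • r) • m = r • m
        rw [inv_one, one_smul] }
  naturality _ _ _ := rfl

variable (k R) in
/-- Twisting by a product. -/
def twistMul (g h : Γ) : twist k R (g * h) ⟶ twist k R h ⋙ twist k R g where
  app M := ConcreteCategory.ofHom (C := ModuleCat R)
    { toFun := fun m : M => m
      map_add' := fun _ _ => rfl
      map_smul' := fun r (m : M) => by
        change ((g * h)⁻¹ • r) • m = (h⁻¹ • g⁻¹ • r) • m
        rw [mul_inv_rev, mul_smul] }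
  naturality _ _ _ := rfl

end SkewMonoidAlgebra

namespace IsYetterDrinfeldHopfAlgebra

open SkewMonoidAlgebra ModuleCat

variable {k Γ R : Type u} [Field k] [Group Γ] [DecidableEq Γ] [Ring R] [Algebra k R]
  [MulSemiringAction Γ R] [SMulCommClass Γ k R] {𝒢 : Γ → Submodule k R}
  [DirectSum.Decomposition 𝒢] [Coalgebra k R] (hR : IsYetterDrinfeldHopfAlgebra 𝒢)

/-- The trivial module of the bosonization restricts to the trivial module. -/
def restrTrivial :
    (restr k Γ R).obj (trivialModule hR.bosonizationAugmentation) ≅ trivialModule hR.augmentation :=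
  restrictScalarsTrivialModule _ _ _ hR.bosonizationAugmentation_comp_inclusion

/-- The twists of the trivial module are trivial. -/
def twistTrivial (g : Γ) :
    (twist k R g).obj (trivialModule hR.augmentation) ≅ trivialModule hR.augmentation :=
  restrictScalarsTrivialModule _ _ _ (hR.augmentation_comp_toAlgHom g⁻¹)

theorem mapConj_twist_one {n : ℕ}
    (α : Ext (trivialModule hR.augmentation) (trivialModule hR.augmentation) n) :
    Ext.mapConj (twist k R 1) (hR.twistTrivial 1) α = α :=
  Ext.mapConj_eq_self _ _ (twistOne k Γ R) rfl α

theorem mapConj_twist_mul (g h : Γ) {n : ℕ}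
    (α : Ext (trivialModule hR.augmentation) (trivialModule hR.augmentation) n) :
    Ext.mapConj (twist k R (g * h)) (hR.twistTrivial (g * h)) α =
      Ext.mapConj (twist k R g) (hR.twistTrivial g)
        (Ext.mapConj (twist k R h) (hR.twistTrivial h) α) :=
  (Ext.mapConj_mapConj _ _ _ _ _ _ (twistMul k R g h) rfl α).symm

/-- The action of the group on the cohomology algebra. -/
def cohomologyAction : Γ →* (CohomologyAlgebra hR.augmentation →ₐ[k]
    CohomologyAlgebra hR.augmentation) where
  toFun g := YonedaExt.mapAlgHom k (twist k R g) (hR.twistTrivial g)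
  map_one' := DirectSum.algHom_ext k _ fun n α => by
    rw [YonedaExt.mapAlgHom_of, mapConj_twist_one]
    rfl
  map_mul' g h := DirectSum.algHom_ext k _ fun n α => by
    rw [AlgHom.mul_apply, YonedaExt.mapAlgHom_of, YonedaExt.mapAlgHom_of, YonedaExt.mapAlgHom_of,
      mapConj_twist_mul]

/-- The action of the group and of signs on the cohomology algebra. -/
def signedCohomologyAction : Γ × ℤˣ →* (CohomologyAlgebra hR.augmentation →ₐ[k]
    CohomologyAlgebra hR.augmentation) :=
  hR.cohomologyAction.noncommCoprod (YonedaExt.signAction k _)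
    fun g s => YonedaExt.commute_signAlgHom k (twist k R g) (hR.twistTrivial g) s

theorem signedCohomologyAction_of (g : Γ) (s : ℤˣ) {n : ℕ}
    (α : Ext (trivialModule hR.augmentation) (trivialModule hR.augmentation) n) :
    hR.signedCohomologyAction (g, s) (DirectSum.of (fun n => Ext _ _ n) n α) =
      (s : ℤ) ^ n • DirectSum.of (fun n => Ext _ _ n) n
        (Ext.mapConj (twist k R g) (hR.twistTrivial g) α) := by
  change hR.cohomologyAction g (YonedaExt.signAlgHom k _ s _) = _
  rw [YonedaExt.signAlgHom_of, map_zsmul]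
  exact congrArg _ (YonedaExt.mapAlgHom_of _ _ _ _)

theorem signedCohomologyAction_one (g : Γ) (x : CohomologyAlgebra hR.augmentation) :
    hR.signedCohomologyAction (g, 1) x = hR.cohomologyAction g x := by
  change hR.cohomologyAction g (YonedaExt.signAction k _ 1 x) = _
  rw [map_one]
  rfl

theorem bosonizationAugmentation_of (g : Γ) : hR.bosonizationAugmentation (of R Γ g) = 1 := by
  rw [of_apply, bosonizationAugmentation_single, hR.counit_one]

/-- The inclusion of the trivial module in the restriction of the induced module. -/
def trivialInl : trivialModule hR.augmentation ⟶
    (restr k Γ R).obj ((ind k Γ R).obj (trivialModule hR.augmentation)) :=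
  (hR.twistTrivial 1).inv ≫ (indInl k R 1).app _

/-- The projections to the trivial module from the restriction of the induced module. -/
def trivialProj (g : Γ) : (restr k Γ R).obj ((ind k Γ R).obj (trivialModule hR.augmentation)) ⟶
    trivialModule hR.augmentation :=
  (indProj k R g).app _ ≫ (hR.twistTrivial g).hom

/-- The restriction of an induced class is diagonal with respect to the twists: on the summand `1`
it is `α`, and on the summand `g`, as `postMap_trivialProj` shows, it is `g · α`. -/
theorem postMap_trivialInl {n : ℕ}
    (α : Ext (trivialModule hR.augmentation) (trivialModule hR.augmentation) n) :
    Ext.postMap α hR.trivialInl = Ext.preMap hR.trivialInl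
      ((α.mapExactFunctor (ind k Γ R)).mapExactFunctor (restr k Γ R)) := by
  have key := Ext.postMap_mapExactFunctor_app (indInl k R (1 : Γ)) α
  rw [Ext.mapExactFunctor_comp_functor] at key
  have h := hR.mapConj_twist_one α
  conv_lhs => rw [← h]
  rw [trivialInl, Ext.mapConj, Ext.postMap_preMap, Ext.postMap_postMap, Iso.hom_inv_id_assoc]
  exact (congrArg (Ext.preMap (hR.twistTrivial 1).inv) key).trans (Ext.preMap_preMap _ _ _)

theorem postMap_trivialProj (g : Γ) {n : ℕ}
    (α : Ext (trivialModule hR.augmentation) (trivialModule hR.augmentation) n) :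
    Ext.postMap ((α.mapExactFunctor (ind k Γ R)).mapExactFunctor (restr k Γ R))
      (hR.trivialProj g) = Ext.preMap (hR.trivialProj g)
      (Ext.mapConj (twist k R g) (hR.twistTrivial g) α) := by
  have key := Ext.postMap_mapExactFunctor_app (indProj k R g) α
  rw [Ext.mapExactFunctor_comp_functor] at key
  rw [trivialProj, ← Ext.preMap_preMap, Ext.preMap_mapConj, ← Ext.postMap_preMap]
  exact (Ext.postMap_postMap _ _ _).symm.trans
    (congrArg (fun β => Ext.postMap β (hR.twistTrivial g).hom) key)

/-- The right unit constraint of the tensor product of modules over the bosonization and over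
`R`. -/
def rightUnit : (tensorBifunctor hR.smashComul).flip.obj (trivialModule hR.augmentation) ≅
    restr k Γ R :=
  tensorRightUnit hR.smashComul hR.augmentation (Y := trivialModule hR.augmentation)
    (AddEquiv.refl k) (fun _ _ => rfl) (inclusion k Γ R) hR.rid_map_smashComul

/-- The left unit constraint of the tensor product of modules over the bosonization and over
`R`. -/
def leftUnit : (tensorBifunctor hR.smashComul).obj (trivialModule hR.bosonizationAugmentation) ⟶
    𝟭 (ModuleCat.{u} R) :=
  tensorLeftUnit hR.smashComul hR.bosonizationAugmentation
    (X := trivialModule hR.bosonizationAugmentation) (AddEquiv.refl k) (fun _ _ => rfl)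
    hR.lid_map_smashComul

theorem leftUnit_app : hR.leftUnit.app (trivialModule hR.augmentation) =
    (Ext.unitIso _ _ hR.rightUnit _).hom ≫ hR.restrTrivial.hom :=
  tensorLeftUnit_app_eq hR.smashComul _ _ _ _ hR.rid_map_smashComul _ _ _ _ _ fun _ => rfl

/-- The component of a cohomology class of `R` of degree `g` in the sense of braided
commutativity. -/
def component (g : Γ) {n : ℕ}
    (β : Ext (trivialModule hR.augmentation) (trivialModule hR.augmentation) n) :
    Ext (trivialModule hR.augmentation) (trivialModule hR.augmentation) n :=
  Ext.twistedComponent (tensorBifunctor hR.smashComul) (restr k Γ R) hR.rightUnit hR.trivialInl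
    (hR.trivialProj g) β

/-- The general commutation rule with `W` the induced trivial module and the class induced from `α`:
this enters at the summand `1` as `α` and leaves at the summand `g` as its twist. -/
theorem comp_component (g : Γ) {m n p : ℕ} (h : m + n = p)
    (α : Ext (trivialModule hR.augmentation) (trivialModule hR.augmentation) m)
    (β : Ext (trivialModule hR.augmentation) (trivialModule hR.augmentation) n) :
    α.comp (hR.component g β) h = (-1 : ℤ) ^ (m * n) •
      (hR.component g β).comp (Ext.mapConj (twist k R g) (hR.twistTrivial g) α) (by lia) :=
  Ext.comp_twistedComponent _ _ _ _ _ (α.mapExactFunctor (ind k Γ R)) _ _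
    (hR.postMap_trivialInl α) (hR.postMap_trivialProj g α) β h

theorem isTwistedCentral_component (g : Γ) {n : ℕ}
    (β : Ext (trivialModule hR.augmentation) (trivialModule hR.augmentation) n) :
    IsTwistedCentral hR.signedCohomologyAction
      (DirectSum.of (fun n => Ext _ _ n) n (hR.component g β)) := by
  -- The sign `(-1) ^ (m * n)` is the action of the unit `(-1) ^ n` on classes of degree `m`.
  refine ⟨(g, (-1) ^ n), fun x => ?_⟩
  induction x using DirectSum.induction_on with
  | zero => simp
  | add x y hx hy => rw [add_mul, hx, hy, map_add, mul_add]
  | of m α =>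
    rw [signedCohomologyAction_of, mul_smul_comm, YonedaExt.of_mul_of _ _ rfl,
      YonedaExt.of_mul_of _ _ (add_comm n m), comp_component, map_zsmul]
    push_cast
    rw [← pow_mul, mul_comm]

/-! ### Invariant classes, and the sum of the components -/

section Transfer

variable [Fintype Γ]

/-- The coinduction unit of the trivial module. -/
def trivialToInd : trivialModule hR.bosonizationAugmentation ⟶
    (ind k Γ R).obj (trivialModule hR.augmentation) :=
  (coindUnit k Γ R).app _ ≫ (ind k Γ R).map hR.restrTrivial.hom

/-- The induction counit of the trivial module. -/
def indToTrivial : (ind k Γ R).obj (trivialModule hR.augmentation) ⟶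
    trivialModule hR.bosonizationAugmentation :=
  (ind k Γ R).map hR.restrTrivial.inv ≫ (indCounit k Γ R).app _

/-- Group elements act as `1` on the trivial module, so the unit is the diagonal map to the
functions on `Γ`; dually, the counit sums the coordinates. -/
theorem restrTrivial_inv_comp_map_trivialToInd :
    hR.restrTrivial.inv ≫ (restr k Γ R).map hR.trivialToInd =
      ∑ g : Γ, (hR.twistTrivial g).inv ≫ (indInl k R g).app _ := by
  refine ModuleCat.hom_ext (LinearMap.ext fun (c : k) => funext fun g => ?_)
  let ψ : (trivialModule hR.augmentation ⟶
      (restr k Γ R).obj ((ind k Γ R).obj (trivialModule hR.augmentation))) →+ k :=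
    AddMonoidHom.mk' (fun φ => (show Γ → k from φ (show k from c)) g) fun _ _ => rfl
  refine Eq.trans ?_ (_root_.map_sum ψ _ _).symm
  change hR.bosonizationAugmentation (of R Γ g⁻¹) * c = ∑ h : Γ, (Pi.single h c : Γ → k) g
  rw [bosonizationAugmentation_of, one_mul]
  exact (Fintype.sum_pi_single g fun _ => c).symm

theorem indInl_app_comp_map_indToTrivial (g : Γ) :
    (indInl k R g).app _ ≫ (restr k Γ R).map hR.indToTrivial ≫ hR.restrTrivial.hom =
      (hR.twistTrivial g).hom := by
  refine ModuleCat.hom_ext (LinearMap.ext fun (c : k) => ?_)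
  change ∑ h : Γ, hR.bosonizationAugmentation (of R Γ h) * (Pi.single g c : Γ → k) h = c
  simp only [bosonizationAugmentation_of, one_mul]
  exact Fintype.sum_pi_single' g c

theorem sum_indProj_app_comp_twistTrivial :
    ∑ g : Γ, (indProj k R g).app _ ≫ (hR.twistTrivial g).hom =
      (restr k Γ R).map hR.indToTrivial ≫ hR.restrTrivial.hom := by
  refine ModuleCat.hom_ext (LinearMap.ext fun (f : Γ → k) => ?_)
  let ψ : ((restr k Γ R).obj ((ind k Γ R).obj (trivialModule hR.augmentation)) ⟶
      trivialModule hR.augmentation) →+ k :=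
    AddMonoidHom.mk' (fun φ => φ (f : Γ → k)) fun _ _ => rfl
  refine (_root_.map_sum ψ _ _).trans ?_
  change ∑ g : Γ, f g = ∑ h : Γ, hR.bosonizationAugmentation (of R Γ h) * f h
  simp only [bosonizationAugmentation_of, one_mul]

/-- Invariant classes are in the image of the restriction map. -/
theorem mem_range_of_invariant [CharZero k] (x : CohomologyAlgebra hR.augmentation)
    (hx : ∀ g, hR.cohomologyAction g x = x) :
    x ∈ (YonedaExt.mapAlgHom k (restr k Γ R) hR.restrTrivial).range := by
  -- The sum of the conjugates of a class is the restriction of its transfer, that is, of the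
  -- induced class composed with the unit and the counit.
  have key (x : CohomologyAlgebra hR.augmentation) : ∑ g : Γ, hR.cohomologyAction g x ∈
      (YonedaExt.mapAlgHom k (restr k Γ R) hR.restrTrivial).range := by
    induction x using DirectSum.induction_on with
    | zero => simp
    | add x y hx hy => simpa only [map_add, Finset.sum_add_distrib] using add_mem hx hy
    | of n α =>
      refine ⟨DirectSum.of (fun n => Ext _ _ n) n (Ext.preMap hR.trivialToInd
        (Ext.postMap (α.mapExactFunctor (ind k Γ R)) hR.indToTrivial)), ?_⟩
      refine (YonedaExt.mapAlgHom_of _ _ _ _).trans ?_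
      rw [Ext.mapConj_transfer (restr k Γ R) hR.restrTrivial (ind k Γ R) (fun g => twist k R g)
        hR.twistTrivial (indInl k R) _ _ hR.restrTrivial_inv_comp_map_trivialToInd
        hR.indInl_app_comp_map_indToTrivial, _root_.map_sum]
      exact Finset.sum_congr rfl fun g _ => (YonedaExt.mapAlgHom_of k _ _ _).symm
  -- For invariant `x` the sum is `|Γ| x`, and `|Γ|` can be divided out.
  have h := key x
  simp only [hx, Finset.sum_const, Finset.card_univ] at h
  have h' := Subalgebra.smul_mem _ h ((Fintype.card Γ : k)⁻¹)
  rwa [← Nat.cast_smul_eq_nsmul k, smul_smul, inv_mul_cancel₀ (Nat.cast_ne_zero.2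
    Fintype.card_ne_zero), one_smul] at h'

/-- The projections to the twists add up to the restricted counit, which is the identity on the
summand `1`. -/
theorem sum_component {n : ℕ}
    (β : Ext (trivialModule hR.augmentation) (trivialModule hR.augmentation) n) :
    ∑ g : Γ, hR.component g β = β := by
  refine Ext.sum_twistedComponent _ _ _ hR.leftUnit hR.restrTrivial hR.leftUnit_app _ _
    hR.indToTrivial ?_ hR.sum_indProj_app_comp_twistTrivial β
  rw [trivialInl, Category.assoc]
  exact (congrArg ((hR.twistTrivial 1).inv ≫ ·) (hR.indInl_app_comp_map_indToTrivial 1)).trans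
    (Iso.inv_hom_id _)

theorem span_isTwistedCentral :
    Submodule.span k {x | IsTwistedCentral hR.signedCohomologyAction x} = ⊤ := by
  refine eq_top_iff.2 fun x _ => ?_
  induction x using DirectSum.induction_on with
  | zero => exact zero_mem _
  | add x y hx hy => exact add_mem (hx trivial) (hy trivial)
  | of n β =>
    rw [← hR.sum_component β, _root_.map_sum]
    exact Submodule.sum_mem _ fun g _ => Submodule.subset_span (hR.isTwistedCentral_component g β)

end Transfer

end IsYetterDrinfeldHopfAlgebra

end

theorem mainTheorem7 {k Γ R : Type u} [Field k] [IsAlgClosed k] [CharZero k]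
    [Group Γ] [Finite Γ] [DecidableEq Γ]
    [Ring R] [Algebra k R] [Module.Finite k R] [Coalgebra k R]
    [MulSemiringAction Γ R] [SMulCommClass Γ k R]
    (𝒢 : Γ → Submodule k R) [DirectSum.Decomposition 𝒢]
    (hR : IsYetterDrinfeldHopfAlgebra 𝒢)
    (hfgc : HasFinitelyGeneratedCohomology hR.augmentation) :
    HasFinitelyGeneratedCohomology hR.bosonizationAugmentation := by
  cases nonempty_fintype Γ
  obtain ⟨B, hB, hBinv, hfin⟩ := exists_subalgebra_finite_of_isTwistedCentral hfgc.finiteType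
    hR.span_isTwistedCentral
  obtain ⟨h₁, h₂⟩ := finite_of_injective_of_finite_subalgebra
    (YonedaExt.mapAlgHom k (SkewMonoidAlgebra.restr k Γ R) hR.restrTrivial)
    (YonedaExt.mapAlgHom_injective k _ _ fun n =>
      SkewMonoidAlgebra.mapExactFunctor_restr_injective k R) B hB
    -- Invariance under `Γ × {±1}` contains invariance under `Γ`, so `B` consists of restrictions of
    -- classes of the bosonization.
    (fun b hb => hR.mem_range_of_invariant _ fun g => by
      rw [← hR.signedCohomologyAction_one, hBinv (g, 1) b hb]) hfin
  refine ⟨h₁, fun M hM => ?_⟩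
  -- A finitely generated module over the bosonization stays finitely generated over `R`, since `Γ`
  -- is finite, so the hypothesis on `R` covers it.
  exact h₂ _ _ (YonedaExt.mapModule (SkewMonoidAlgebra.restr k Γ R) hR.restrTrivial M)
    (hfgc.finite _ (SkewMonoidAlgebra.finite_restr M))
    (YonedaExt.mapModule_injective _ _ _ fun n =>
      SkewMonoidAlgebra.mapExactFunctor_restr_injective k R)
    (YonedaExt.mapModule_smul k _ _ M)
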